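/- Let $V$ be a finite-dimensional complex vector space, $G\subset GL(V)$ a finite subgroup, and $\alpha:G\times G\to\mathbb{C}^\times$ a normalized two-cocycle, i.e. $\alpha(g,h)\alpha(gh,k)=\alpha(h,k)\alpha(g,hk)$ and $\alpha(1,g)=\alpha(g,1)=1$. For an algebra $S$ on which $G$ acts by automorphisms, $S\#_\alpha G$ is $S\otimes\mathbb{C}G$ with product $(r\otimes g)(s\otimes h)=\alpha(g,h)\,r(g\cdot s)\otimes gh$; write $\overline g=1\otimes g$. Given skew-symmetric bilinear forms $a_k:V\times V\to\mathbb{C}$ $(k\in G)$ and an indeterminate $t$, let $A$ be the quotient of $T(V)\#_\alpha G[t]=\mathbb{C}[t]\otimes(T(V)\#_\alpha G)$ by the two-sided ideal generated by all $$vw-wv-\sum_{k\in G}a_k(v,w)\,t\,\overline{k}\qquad(v,w\in V).$$ $A$ is called a *twisted graded Hecke algebra* if the $\mathbb{C}[t]$-linear map $S(V)\otimes\mathbb{C}G[t]\to A$ induced by any degree-preserving linear section $S(V)\to T(V)$ of the canonical projection $T(V)\to S(V)$ is bijective. Fix a $G$-invariant nondegenerate Hermitian form on $V$. For $g\in G$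 let $V^g=\{v\in V: gv=v\}$, let $(V^g)^\perp$ be its orthogonal complement (one has $V=V^g\oplus(V^g)^\perp$), and for $h\in G$ let $h^\perp:(V^g)^\perp\to(V^g)^\perp$ be the composition of $h:(V^g)^\perp\to V$, the projection $V\to V/V^g$ and the natural isomorphism $V/V^g\cong(V^g)^\perp$. Let $C(g)=\{h\in G: hg=gh\}$ and, for a bilinear form $b$, $\operatorname{Ker} b=\{v: b(v,w)=0\ \forall w\in V\}$. **Theorem.** Let $g\in G$, $g\neq1$. 1. There is a twisted graded Hecke algebra (for $G$ and $\alpha$) with $a_g\neq0$ if and only if $\operatorname{codim}V^g=2$ and $\det(h^\perp)=\alpha(h,g)\alpha(g,h)^{-1}$ for all $h\in C(g)$. 2. More precisely, for every skew-symmetric bilinear form $b$ on $V$: $b\neq0$ and there is a twisted graded Hecke algebra (for $G$ and $\alpha$) with $a_g=b$, if and only if $\operatorname{Ker}b=V^g$, $\operatorname{codim}V^g=2$, and $\det(h^\perp)=\alpha(h,g)\alpha(g,h)^{-1}$ for all $h\in C(g)$. -/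

import Mathlib

open scoped TensorProduct Polynomial

noncomputable section

/-- A normalized two-cocycle on `G` with values in `ℂˣ` (trivial action). -/
structure NormalizedTwoCocycle (G : Type*) [Group G] where
  toFun : G → G → ℂˣ
  cocycle : ∀ g h k : G, toFun g h * toFun (g * h) k = toFun h k * toFun g (h * k)
  one_left : ∀ g : G, toFun 1 g = 1
  one_right : ∀ g : G, toFun g 1 = 1

instance {G : Type*} [Group G] :
    CoeFun (NormalizedTwoCocycle G) (fun _ => G → G → ℂˣ) := ⟨NormalizedTwoCocycle.toFun⟩

/-! ### Crossed products -/

section CrossedProduct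

variable {G : Type*} [Group G] {S : Type*} [Ring S] [Algebra ℂ S]

/-- The crossed product algebra `S #_α G` of a `ℂ`-algebra `S` by a group `G` acting on it by
algebra automorphisms through `φ`. As a vector space it is `S ⊗ ℂG`, realized as the finitely
supported functions `G →₀ S`; the element `s ⊗ g` is `Finsupp.single g s`. -/
@[nolint unusedArguments]
def CrossedProduct (_φ : G →* (S →ₐ[ℂ] S)) (_α : NormalizedTwoCocycle G) : Type _ := G →₀ S

namespace CrossedProduct

variable (φ : G →* (S →ₐ[ℂ] S)) (α : NormalizedTwoCocycle G)

instance : AddCommGroup (CrossedProduct φ α) := inferInstanceAs (AddCommGroup (G →₀ S))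

instance : Module ℂ (CrossedProduct φ α) := inferInstanceAs (Module ℂ (G →₀ S))

/-- The linear map `s ↦ s ⊗ g`. -/
def of (g : G) : S →ₗ[ℂ] CrossedProduct φ α := Finsupp.lsingle (R := ℂ) (M := S) g

/-- The multiplication `(r ⊗ g) (s ⊗ h) = α(g, h) r (g · s) ⊗ g h`, extended bilinearly. -/
def mulLin : CrossedProduct φ α →ₗ[ℂ] CrossedProduct φ α →ₗ[ℂ] CrossedProduct φ α :=
  Finsupp.lsum ℂ (M := S) fun g =>
    LinearMap.flip <| Finsupp.lsum ℂ (M := S) fun h =>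
      LinearMap.flip <|
        ((LinearMap.mul ℂ S).compl₂ (φ g).toLinearMap).compr₂
          ((α g h : ℂ) • of φ α (g * h))

instance : Mul (CrossedProduct φ α) := ⟨fun x y => mulLin φ α x y⟩

instance : One (CrossedProduct φ α) := ⟨of φ α 1 1⟩

variable {φ α}

theorem mul_def (x y : CrossedProduct φ α) : x * y = mulLin φ α x y := rfl

theorem one_def : (1 : CrossedProduct φ α) = of φ α 1 1 := rfl

theorem of_mul_of (g h : G) (r s : S) :
    of φ α g r * of φ α h s = (α g h : ℂ) • of φ α (g * h) (r * φ g s) := by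
  have h1 := Finsupp.lsum_single (R := ℂ) ℂ (fun g : G =>
    LinearMap.flip <| Finsupp.lsum ℂ (M := S) fun h : G =>
      LinearMap.flip <|
        ((LinearMap.mul ℂ S).compl₂ (φ g).toLinearMap).compr₂
          ((α g h : ℂ) • of φ α (g * h))) g r
  have h2 := Finsupp.lsum_single (R := ℂ) ℂ (fun h : G =>
      LinearMap.flip <|
        ((LinearMap.mul ℂ S).compl₂ (φ g).toLinearMap).compr₂
          ((α g h : ℂ) • of φ α (g * h))) h s
  exact (LinearMap.congr_fun h1 _).trans (LinearMap.congr_fun h2 r)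

theorem induction {p : CrossedProduct φ α → Prop} (h0 : p 0)
    (hadd : ∀ x y, p x → p y → p (x + y)) (hof : ∀ g s, p (of φ α g s))
    (x : CrossedProduct φ α) : p x :=
  Finsupp.induction_linear (motive := p) x h0 hadd hof

protected theorem mul_add' (x y z : CrossedProduct φ α) : x * (y + z) = x * y + x * z := by
  simp only [mul_def, map_add]

protected theorem add_mul' (x y z : CrossedProduct φ α) : (x + y) * z = x * z + y * z := by
  simp only [mul_def, map_add, LinearMap.add_apply]

protected theorem zero_mul' (x : CrossedProduct φ α) : 0 * x = 0 := by
  simp only [mul_def, map_zero, LinearMap.zero_apply]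

protected theorem mul_zero' (x : CrossedProduct φ α) : x * 0 = 0 := by
  simp only [mul_def, map_zero]

protected theorem smul_mul' (c : ℂ) (x y : CrossedProduct φ α) : (c • x) * y = c • (x * y) := by
  simp only [mul_def, map_smul, LinearMap.smul_apply]

protected theorem mul_smul' (c : ℂ) (x y : CrossedProduct φ α) : x * (c • y) = c • (x * y) := by
  simp only [mul_def, map_smul]

protected theorem mul_assoc' (x y z : CrossedProduct φ α) : x * y * z = x * (y * z) := by
  induction x using induction with
  | h0 => simp only [CrossedProduct.zero_mul']
  | hadd a b ha hb => simp only [CrossedProduct.add_mul', ha, hb]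
  | hof g r =>
    induction y using induction with
    | h0 => simp only [CrossedProduct.zero_mul', CrossedProduct.mul_zero']
    | hadd a b ha hb => simp only [CrossedProduct.add_mul', CrossedProduct.mul_add', ha, hb]
    | hof h s =>
      induction z using induction with
      | h0 => simp only [CrossedProduct.mul_zero']
      | hadd a b ha hb => simp only [CrossedProduct.mul_add', ha, hb]
      | hof k t =>
        have hc : (α g h : ℂ) * (α (g * h) k : ℂ) = (α h k : ℂ) * (α g (h * k) : ℂ) := by
          exact_mod_cast congrArg Units.val (α.cocycle g h k)
        simp only [of_mul_of, CrossedProduct.smul_mul', CrossedProduct.mul_smul', smul_smul, hc,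
          map_mul, AlgHom.mul_apply, mul_assoc]

protected theorem one_mul' (x : CrossedProduct φ α) : 1 * x = x := by
  induction x using induction with
  | h0 => exact CrossedProduct.mul_zero' _
  | hadd a b ha hb => rw [CrossedProduct.mul_add', ha, hb]
  | hof g r => simp [one_def, of_mul_of, α.one_left]

protected theorem mul_one' (x : CrossedProduct φ α) : x * 1 = x := by
  induction x using induction with
  | h0 => exact CrossedProduct.zero_mul' _
  | hadd a b ha hb => rw [CrossedProduct.add_mul', ha, hb]
  | hof g r => simp [one_def, of_mul_of, α.one_right]

instance : Ring (CrossedProduct φ α) where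
  __ := (inferInstance : AddCommGroup (CrossedProduct φ α))
  left_distrib := CrossedProduct.mul_add'
  right_distrib := CrossedProduct.add_mul'
  zero_mul := CrossedProduct.zero_mul'
  mul_zero := CrossedProduct.mul_zero'
  mul_assoc := CrossedProduct.mul_assoc'
  one_mul := CrossedProduct.one_mul'
  mul_one := CrossedProduct.mul_one'

instance : Algebra ℂ (CrossedProduct φ α) :=
  Algebra.ofModule CrossedProduct.smul_mul' CrossedProduct.mul_smul'

end CrossedProduct

end CrossedProduct

/-! ### The algebra `A` attached to a family of bilinear forms -/

namespace TwistedHecke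

variable {V : Type*} [AddCommGroup V] [Module ℂ V]

/-- Skew-symmetry of a bilinear form. -/
def IsSkew (b : V →ₗ[ℂ] V →ₗ[ℂ] ℂ) : Prop := ∀ v w : V, b v w = - b w v

/-- The action of a subgroup of `GL(V)` on the tensor algebra `T(V)` by algebra automorphisms,
extending its action on `V`. -/
def tensorAction (G : Subgroup (LinearMap.GeneralLinearGroup ℂ V)) :
    G →* (TensorAlgebra ℂ V →ₐ[ℂ] TensorAlgebra ℂ V) where
  toFun g := TensorAlgebra.lift ℂ
    (TensorAlgebra.ι ℂ ∘ₗ ((g : LinearMap.GeneralLinearGroup ℂ V) : V →ₗ[ℂ] V))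
  map_one' := by
    ext v
    simp
  map_mul' g h := by
    ext v
    simp

variable {G : Subgroup (LinearMap.GeneralLinearGroup ℂ V)} (α : NormalizedTwoCocycle G)

/-- `T(V) #_α G`. -/
abbrev TensorCrossed : Type _ := CrossedProduct (tensorAction G) α

/-- `T(V) #_α G [t] = ℂ[t] ⊗ (T(V) #_α G)`. -/
abbrev TensorCrossedPoly : Type _ := ℂ[X] ⊗[ℂ] TensorCrossed α

/-- A vector of `V` as an element of `T(V) #_α G [t]`. -/
def vec (v : V) : TensorCrossedPoly α :=
  1 ⊗ₜ CrossedProduct.of (tensorAction G) α 1 (TensorAlgebra.ι ℂ v)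

/-- The element `t ḡ` of `T(V) #_α G [t]`, where `t` is the indeterminate. -/
def tBar (g : G) : TensorCrossedPoly α :=
  (Polynomial.X : ℂ[X]) ⊗ₜ CrossedProduct.of (tensorAction G) α g 1

section Quotient

variable [Finite G] (a : G → V →ₗ[ℂ] V →ₗ[ℂ] ℂ)

/-- The defining relations `[v, w] = ∑ g, a_g(v, w) t ḡ`. -/
inductive Rel : TensorCrossedPoly α → TensorCrossedPoly α → Prop
  | bracket (v w : V) :
      Rel (vec α v * vec α w - vec α w * vec α v) (∑ᶠ g : G, a g v w • tBar α g)

/-- The quotient `A` of `T(V) #_α G [t]` by the two-sided ideal generated by all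
`[v, w] - ∑ g, a_g(v, w) t ḡ`. -/
abbrev HeckeQuotient : Type _ := RingQuot (Rel α a)

variable (V) in
/-- A graded linear section `S(V) → T(V)` of the canonical projection `T(V) → S(V)`: the image in
`S(V)` of the degree `n` part of `T(V)` is sent into the degree `n` part of `T(V)`. -/
structure GradedSection where
  toLin : SymmetricAlgebra ℂ V →ₗ[ℂ] TensorAlgebra ℂ V
  section_apply : ∀ s, SymmetricAlgebra.algHom ℂ V (toLin s) = s
  graded : ∀ (n : ℕ), ∀ x ∈ (LinearMap.range (TensorAlgebra.ι ℂ (M := V))) ^ n,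
    toLin (SymmetricAlgebra.algHom ℂ V x) ∈ (LinearMap.range (TensorAlgebra.ι ℂ (M := V))) ^ n

/-- The `ℂ[t]`-linear map `S(V) ⊗ ℂG [t] → T(V) #_α G [t] → A` given by a section `S(V) → T(V)`;
`S(V) ⊗ ℂG` is realized as `G →₀ S(V)`. -/
def pbwMap (σ : GradedSection V) :
    ℂ[X] ⊗[ℂ] (G →₀ SymmetricAlgebra ℂ V) →ₗ[ℂ[X]] HeckeQuotient α a :=
  (RingQuot.mkAlgHom ℂ[X] (Rel α a)).toLinearMap ∘ₗ
    LinearMap.baseChange ℂ[X]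
      (show (G →₀ SymmetricAlgebra ℂ V) →ₗ[ℂ] TensorCrossed α from
        Finsupp.mapRange.linearMap σ.toLin)

/-- `A` is a twisted graded Hecke algebra: the forms are skew-symmetric and the map
`S(V) ⊗ ℂG [t] → A` given by any graded linear section is an isomorphism of `ℂ[t]`-modules. -/
def IsTwistedGradedHecke : Prop :=
  (∀ g, IsSkew (a g)) ∧ ∀ σ : GradedSection V, Function.Bijective (pbwMap α a σ)

end Quotient

/-! ### Graded sections exist -/

open scoped Pointwise in
theorem nonempty_gradedSection [FiniteDimensional ℂ V] : Nonempty (GradedSection V) := by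
  classical
  let b := Module.finBasis ℂ V
  let n := Module.finrank ℂ V
  let T := LinearMap.range (TensorAlgebra.ι ℂ (M := V))
  let e := SymmetricAlgebra.equivMvPolynomial b
  have he : ∀ i, e (SymmetricAlgebra.algHom ℂ V (TensorAlgebra.ι ℂ (b i))) = MvPolynomial.X i := by
    intro i
    exact SymmetricAlgebra.equivMvPolynomial_ι_apply b i
  -- ordered monomials
  let w : (Fin n →₀ ℕ) → TensorAlgebra ℂ V := fun m =>
    (List.ofFn fun i => TensorAlgebra.ι ℂ (b i) ^ m i).prod
  have hw : ∀ m, e (SymmetricAlgebra.algHom ℂ V (w m)) = MvPolynomial.monomial m 1 := by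
    intro m
    simp only [w, map_list_prod, List.map_ofFn, Function.comp_def, map_pow, List.prod_ofFn]
    rw [map_prod]
    simp only [map_pow]
    rw [MvPolynomial.monomial_eq, Finsupp.prod_fintype _ _ (by simp), map_one, one_mul]
    exact Finset.prod_congr rfl fun i _ => congrArg (· ^ m i) (he i)
  have hwdeg : ∀ m, w m ∈ T ^ (∑ i, m i) := by
    intro m
    have key : ∀ (k : ℕ) (f : Fin k → V) (d : Fin k → ℕ),
        (List.ofFn fun i => TensorAlgebra.ι ℂ (f i) ^ d i).prod ∈ T ^ (∑ i, d i) := by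
      intro k
      induction k with
      | zero => intro f d; simp
      | succ k ih =>
        intro f d
        rw [List.ofFn_succ, List.prod_cons, Fin.sum_univ_succ, pow_add]
        exact Submodule.mul_mem_mul
          (Submodule.pow_mem_pow _ (LinearMap.mem_range_self _ _) _) (ih _ _)
    exact key n (fun i => b i) m
  let τ : MvPolynomial (Fin n) ℂ →ₗ[ℂ] TensorAlgebra ℂ V :=
    (MvPolynomial.basisMonomials (Fin n) ℂ).constr ℂ w
  have hτ : ∀ m, τ (MvPolynomial.monomial m 1) = w m := by
    intro m
    have := (MvPolynomial.basisMonomials (Fin n) ℂ).constr_basis ℂ w m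
    rwa [MvPolynomial.coe_basisMonomials] at this
  refine ⟨⟨τ ∘ₗ e.toLinearMap, ?_, ?_⟩⟩
  · intro s
    have h : (e.toLinearMap ∘ₗ (SymmetricAlgebra.algHom ℂ V).toLinearMap) ∘ₗ τ
        = LinearMap.id := by
      refine (MvPolynomial.basisMonomials (Fin n) ℂ).ext fun m => ?_
      simp only [MvPolynomial.coe_basisMonomials, LinearMap.comp_apply, hτ, LinearMap.id_apply]
      exact hw m
    apply e.injective
    exact LinearMap.congr_fun h (e s)
  · intro d x hx
    have hT : T = Submodule.span ℂ (Set.range fun i => TensorAlgebra.ι ℂ (b i)) := by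
      simp only [T]
      rw [LinearMap.range_eq_map, ← b.span_eq, Submodule.map_span, ← Set.range_comp]
      rfl
    have hmon : ∀ (d : ℕ), ∀ x ∈ (Set.range fun i => TensorAlgebra.ι ℂ (b i)) ^ d,
        ∃ m : Fin n →₀ ℕ, ∑ i, m i = d ∧
          e (SymmetricAlgebra.algHom ℂ V x) = MvPolynomial.monomial m 1 := by
      intro d
      induction d with
      | zero =>
        intro x hx
        rw [pow_zero, Set.mem_one] at hx
        exact ⟨0, by simp, by rw [hx, map_one, map_one]; rfl⟩
      | succ d ih =>
        intro x hx
        rw [pow_succ, Set.mem_mul] at hx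
        obtain ⟨y, hy, z, ⟨i, rfl⟩, rfl⟩ := hx
        obtain ⟨m, hm, hme⟩ := ih y hy
        refine ⟨m + Finsupp.single i 1, ?_, ?_⟩
        · simp [Finset.sum_add_distrib, hm, Finsupp.single_apply]
        · rw [map_mul, map_mul, hme, he, MvPolynomial.X, MvPolynomial.monomial_mul, one_mul]
    change x ∈ T ^ d at hx
    rw [hT, Submodule.span_pow] at hx
    induction hx using Submodule.span_induction with
    | mem x hx =>
      obtain ⟨m, hm, hme⟩ := hmon d x hx
      have : (τ ∘ₗ e.toLinearMap) (SymmetricAlgebra.algHom ℂ V x) = w m := by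
        rw [← hτ m, ← hme]; rfl
      rw [this, ← hm]
      exact hwdeg m
    | zero => rw [map_zero, map_zero]; exact Submodule.zero_mem _
    | add x y _ _ hx hy => rw [map_add, map_add]; exact Submodule.add_mem _ hx hy
    | smul c x _ hx => rw [map_smul, map_smul]; exact Submodule.smul_mem _ _ hx

/-! ### Fixed spaces, orthogonal complements and `h^⊥` -/

/-- A `G`-invariant nondegenerate Hermitian form on `V`, conjugate-linear in the first
variable. -/
structure InvariantHermitianForm (G : Subgroup (LinearMap.GeneralLinearGroup ℂ V)) where
  form : V →ₗ⋆[ℂ] V →ₗ[ℂ] ℂ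
  hermitian : ∀ v w : V, form w v = starRingEnd ℂ (form v w)
  nondegenerate : form.Nondegenerate
  invariant : ∀ (g : G) (v w : V), form (g • v) (g • w) = form v w

/-- The fixed space `V^g`. -/
def fixedSpace (g : LinearMap.GeneralLinearGroup ℂ V) : Submodule ℂ V where
  carrier := {v | g • v = v}
  add_mem' {v w} hv hw := by
    simp only [Set.mem_ofPred_eq] at hv hw ⊢
    rw [smul_add, hv, hw]
  zero_mem' := smul_zero g
  smul_mem' c v hv := by
    simp only [Set.mem_ofPred_eq] at hv ⊢
    rw [Units.smul_def, Module.End.smul_def, map_smul, ← Module.End.smul_def, ← Units.smul_def, hv]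

/-- The orthogonal complement `(V^g)^⊥`. -/
def perpSpace (B : InvariantHermitianForm G) (g : G) : Submodule ℂ V :=
  (fixedSpace (g : LinearMap.GeneralLinearGroup ℂ V)).orthogonalBilin B.form

theorem mem_perpSpace (B : InvariantHermitianForm G) (g : G) (v : V) :
    v ∈ perpSpace B g ↔ ∀ u : V, g • u = u → B.form u v = 0 := Iff.rfl

theorem isCompl_fixedSpace_perpSpace [Finite G] (B : InvariantHermitianForm G) (g : G) :
    IsCompl (fixedSpace (g : LinearMap.GeneralLinearGroup ℂ V)) (perpSpace B g) := by
  have hr : 0 < orderOf g := orderOf_pos g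
  have hr' : (orderOf g : ℂ) ≠ 0 := by exact_mod_cast hr.ne'
  let avg : V → V := fun w => ∑ k ∈ Finset.range (orderOf g), (g ^ k) • w
  have havg : ∀ w, g • avg w = avg w := by
    intro w
    simp only [avg, Finset.smul_sum, smul_smul, ← pow_succ']
    have h1 := Finset.sum_range_succ (fun k => (g ^ k) • w) (orderOf g)
    have h2 := Finset.sum_range_succ' (fun k => (g ^ k) • w) (orderOf g)
    rw [h1, pow_orderOf_eq_one, pow_zero] at h2
    exact (add_right_cancel h2).symm
  have hpow : ∀ u : V, g • u = u → ∀ k : ℕ, (g ^ k) • u = u := by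
    intro u hu k
    induction k with
    | zero => simp
    | succ k ih => rw [pow_succ, mul_smul, hu, ih]
  have hB : ∀ u w : V, g • u = u → B.form u (avg w) = (orderOf g : ℂ) * B.form u w := by
    intro u w hu
    simp only [avg, map_sum]
    rw [Finset.sum_congr rfl (g := fun _ => B.form u w), Finset.sum_const, Finset.card_range,
      nsmul_eq_mul]
    intro k _
    conv_lhs => rw [← hpow u hu k]
    exact B.invariant _ _ _
  constructor
  · rw [Submodule.disjoint_def]
    intro v hv hv'
    refine B.nondegenerate.1 v fun w => ?_
    have h1 : B.form v (avg w) = 0 := by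
      rw [B.hermitian (avg w) v, hv' (avg w) (havg w), map_zero]
    rw [hB v w hv] at h1
    exact (mul_eq_zero.1 h1).resolve_left hr'
  · rw [codisjoint_iff, Submodule.eq_top_iff']
    intro w
    refine Submodule.mem_sup.2
      ⟨(orderOf g : ℂ)⁻¹ • avg w, Submodule.smul_mem _ _ (havg w),
        w - (orderOf g : ℂ)⁻¹ • avg w, ?_, by abel⟩
    intro u hu
    change B.form u _ = 0
    rw [map_sub, map_smul, hB u w hu, smul_eq_mul, inv_mul_cancel_left₀ hr', sub_self]

/-- `h^⊥ : (V^g)^⊥ → (V^g)^⊥`, the composition of `h : (V^g)^⊥ → V`, the projection `V → V / V^g`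
and the natural isomorphism `V / V^g ≃ (V^g)^⊥` (the inverse of the restriction of the projection
to `(V^g)^⊥`). -/
def hPerp [Finite G] (B : InvariantHermitianForm G) (g h : G) :
    perpSpace B g →ₗ[ℂ] perpSpace B g :=
  (Submodule.quotientEquivOfIsCompl _ _ (isCompl_fixedSpace_perpSpace B g)).toLinearMap ∘ₗ
    (fixedSpace (g : LinearMap.GeneralLinearGroup ℂ V)).mkQ ∘ₗ
      ((h : LinearMap.GeneralLinearGroup ℂ V) : V →ₗ[ℂ] V) ∘ₗ (perpSpace B g).subtype

end TwistedHecke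

end

/-! The theorem reduces to a Poincaré–Birkhoff–Witt criterion: `A` is a twisted graded Hecke algebra
iff the family `a` is `IsAdmissible`, i.e. skew, compatible with conjugation by the elements ḡ, and
subject to a Jacobi identity for each `k`.

Necessity (`IsTwistedGradedHecke.isAdmissible`): in `A`, the identity ḡ[v, w] = [gv, gw]ḡ and the
Jacobi identity for commutators become relations t · ∑ σ(c_k) k̄ = 0 with c_k of degree at most 1.
Injectivity of the PBW map forces every c_k to vanish, and these are the two conditions.

Sufficiency (`IsAdmissible.isTwistedGradedHecke`): surjectivity holds for any forms, since sorting a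
word changes it by t times terms of lower degree. Injectivity rests on t being a nonzerodivisor in
`A`. Division by t is written down explicitly: a word minus its sorting is t times an element
`sortDefect` of `A`, and admissibility makes the resulting linear map T(V) #_α G [t] → A
(`polyDefect`) respect the relations, so that it undoes multiplication by t. Setting t = 0 still
leaves all of S(V) ⊗ ℂG, so an element of the kernel of the PBW map has no constant term, can be
divided by t, and by induction has no coefficients at all.

The rest is linear algebra. For g ≠ 1 and a_g ≠ 0, the Jacobi identity gives V^g ⊆ Ker a_g and rank
(g - 1) ≤ 2, while a nonzero skew form has rank at least 2; hence Ker a_g = V^g has codimension 2.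
Then a_g is an area form on V / V^g, which h ∈ C(g) scales by det h^⊥, and conjugation compatibility
equates this factor with the cocycle ratio. Conversely, a skew form b with kernel V^g of codimension
2 satisfies the Jacobi identity, its sum over conjugates `conjugateForm` is admissible, and the
determinant condition makes the centralizer fix b, so that the component at g is b itself. -/

set_option linter.unusedSectionVars false

noncomputable section

/-! ### Normal ordering of words

In a ring with a central element `t` and elements `e i` satisfying
`e i * e j - e j * e i = t * κ i j`, sorting a word in the `e i` changes its value by a multiple
of `t`. The quotient by `t` can be chosen coherently when the `κ i j` satisfy the Jacobi identity.
-/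

namespace NormalOrdering

variable {ι A : Type*} [Ring A]

/-- The value of a word. -/
def word (e : ι → A) (l : List ι) : A := (l.map e).prod

@[simp] theorem word_nil (e : ι → A) : word e [] = 1 := rfl

@[simp] theorem word_cons (e : ι → A) (i : ι) (l : List ι) : word e (i :: l) = e i * word e l := by
  simp [word]

theorem word_append (e : ι → A) (l l' : List ι) : word e (l ++ l') = word e l * word e l' := by
  simp [word]

variable [LinearOrder ι]

/-- The quotient by `t` of the difference between `e i` times a sorted word and the sorted word
with `i` inserted. -/
def insertDefect (e : ι → A) (κ : ι → ι → A) (i : ι) : List ι → A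
  | [] => 0
  | j :: l => if i ≤ j then 0 else κ i j * word e l + e j * insertDefect e κ i l

/-- The quotient by `t` of the difference between a word and its sorting. -/
def sortDefect (e : ι → A) (κ : ι → ι → A) : List ι → A
  | [] => 0
  | i :: l => e i * sortDefect e κ l + insertDefect e κ i (l.insertionSort (· ≤ ·))

theorem insertDefect_eq_zero (e : ι → A) (κ : ι → ι → A) (i : ι) (l : List ι)
    (h : ∀ j ∈ l, i ≤ j) : insertDefect e κ i l = 0 := by
  cases l with
  | nil => rfl
  | cons j l => simp [insertDefect, h j]

theorem orderedInsert_of_forall_le (i : ι) (l : List ι) (h : ∀ j ∈ l, i ≤ j) :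
    l.orderedInsert (· ≤ ·) i = i :: l := by
  cases l with
  | nil => rfl
  | cons j l => simp [h j]

theorem insertionSort_eq_of_perm {l l' : List ι} (h : l.Perm l') :
    l.insertionSort (· ≤ ·) = l'.insertionSort (· ≤ ·) :=
  List.Perm.eq_of_pairwise (le := (· ≤ ·)) (fun _ _ _ _ => le_antisymm)
    (List.pairwise_insertionSort _ _) (List.pairwise_insertionSort _ _)
    ((List.perm_insertionSort _ l).trans (h.trans (List.perm_insertionSort _ l').symm))

variable {e : ι → A} {κ : ι → ι → A} {t : A}

theorem mul_insertDefect (ht : ∀ x, t * x = x * t)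
    (hκ : ∀ i j, e i * e j - e j * e i = t * κ i j) (i : ι) (l : List ι) :
    t * insertDefect e κ i l = e i * word e l - word e (l.orderedInsert (· ≤ ·) i) := by
  induction l with
  | nil => simp [insertDefect]
  | cons j l ih =>
    by_cases h : i ≤ j
    · simp [insertDefect, h]
    · simp only [insertDefect, h, if_false, List.orderedInsert_cons, word_cons]
      rw [mul_add, ← mul_assoc, ← hκ, ← mul_assoc, ht (e j), mul_assoc (e j), ih]
      noncomm_ring

theorem mul_sortDefect (ht : ∀ x, t * x = x * t)
    (hκ : ∀ i j, e i * e j - e j * e i = t * κ i j) (l : List ι) :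
    t * sortDefect e κ l = word e l - word e (l.insertionSort (· ≤ ·)) := by
  induction l with
  | nil => simp [sortDefect]
  | cons i l ih =>
    simp only [sortDefect, List.insertionSort_cons, word_cons]
    rw [mul_add, ← mul_assoc, ht (e i), mul_assoc, ih, mul_insertDefect ht hκ]
    noncomm_ring

/-- Inserting `i` and `k` in either order yields the same sorted word, so t times this identity is
immediate from `mul_insertDefect`. The content is that it holds before multiplying by t, which may
be a zero divisor here; this is where the Jacobi identity enters. -/
theorem insertDefect_orderedInsert (ht : ∀ x, t * x = x * t)
    (hκ : ∀ i j, e i * e j - e j * e i = t * κ i j)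
    (hskew : ∀ i j, κ j i = - κ i j) (halt : ∀ i, κ i i = 0)
    (hjac : ∀ i j k, (κ i j * e k - e k * κ i j) + (κ j k * e i - e i * κ j k)
      + (κ k i * e j - e j * κ k i) = 0) (i k : ι) (l : List ι) (hl : l.Pairwise (· ≤ ·)) :
    e i * insertDefect e κ k l - e k * insertDefect e κ i l
      + insertDefect e κ i (l.orderedInsert (· ≤ ·) k)
      - insertDefect e κ k (l.orderedInsert (· ≤ ·) i) = κ i k * word e l := by
  induction l generalizing i k with
  | nil =>
    rcases lt_trichotomy i k with h | rfl | h
    · simp [insertDefect, h.le, h.not_ge, hskew i k]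
    · simp [halt]
    · simp [insertDefect, h.le, h.not_ge]
  | cons j l ih =>
    -- Both sides change sign when `i` and `k` are exchanged, so the case `i < k` suffices.
    have key : ∀ i k, i < k →
        e i * insertDefect e κ k (j :: l) - e k * insertDefect e κ i (j :: l)
          + insertDefect e κ i ((j :: l).orderedInsert (· ≤ ·) k)
          - insertDefect e κ k ((j :: l).orderedInsert (· ≤ ·) i)
          = κ i k * word e (j :: l) := by
      intro i k hik
      have hjl : ∀ m ∈ l, j ≤ m := (List.pairwise_cons.1 hl).1
      by_cases hij : i ≤ j
      · have hs : ∀ m ∈ j :: l, i ≤ m := by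
          intro m hm
          rcases List.mem_cons.1 hm with rfl | hm
          · exact hij
          · exact hij.trans (hjl m hm)
        have h1 : insertDefect e κ i (j :: l) = 0 := insertDefect_eq_zero e κ i _ hs
        have h2 : insertDefect e κ i ((j :: l).orderedInsert (· ≤ ·) k) = 0 := by
          refine insertDefect_eq_zero e κ i _ fun m hm => ?_
          rcases (List.mem_orderedInsert _).1 hm with rfl | hm
          · exact hik.le
          · exact hs m hm
        rw [h1, h2, orderedInsert_of_forall_le i _ hs]
        -- Here `i` belongs in front, and the only surviving contribution is `k` passing `i`.
        conv_lhs => rw [insertDefect.eq_2 e κ k i (j :: l), if_neg hik.not_ge]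
        rw [hskew i k]
        noncomm_ring
      · have hkj : ¬ k ≤ j := fun h => hij (hik.le.trans h)
        have h1 := ih i k (List.pairwise_cons.1 hl).2
        have h2 := hjac i j k
        have h3 := mul_insertDefect ht hκ k l
        have h4 := mul_insertDefect ht hκ i l
        have h5 := hskew i k
        have h6 := hκ i j
        have h7 := hκ k j
        have h8 := hskew j k
        simp only [List.orderedInsert_cons, hij, hkj, if_false, insertDefect, word_cons]
        generalize insertDefect e κ k l = pk at *
        generalize insertDefect e κ i l = pi at *
        generalize insertDefect e κ i (l.orderedInsert (· ≤ ·) k) = pik at *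
        generalize insertDefect e κ k (l.orderedInsert (· ≤ ·) i) = pki at *
        generalize word e (l.orderedInsert (· ≤ ·) k) = zk at *
        generalize word e (l.orderedInsert (· ≤ ·) i) = zi at *
        generalize word e l = z at *
        obtain rfl : zk = e k * z - t * pk := by rw [h3]; abel
        obtain rfl : zi = e i * z - t * pi := by rw [h4]; abel
        have h9 : pik = κ i k * z - e i * pk + e k * pi + pki := by rw [← h1]; abel
        -- Both letters pass `j`. Centrality of `t` matches these commutators with the `t * pk` and
        -- `t * pi` coming from the inserted words.
        have h10 : (e i * e j - e j * e i) * pk = κ i j * (t * pk) := by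
          rw [h6, ht, mul_assoc]
        have h11 : (e k * e j - e j * e k) * pi = κ k j * (t * pi) := by
          rw [h7, ht, mul_assoc]
        -- The Jacobi identity for `i`, `j`, `k`, which settles the terms left once the induction
        -- hypothesis has been used.
        have h12 : κ k j * e i - e i * κ k j - (κ i j * e k - e k * κ i j)
            = e j * κ i k - κ i k * e j := by
          rw [h5] at h2
          rw [h8]
          linear_combination (norm := noncomm_ring) -h2
        rw [h9]
        linear_combination (norm := noncomm_ring) h10 - h11 - h12 * z
    rcases lt_trichotomy i k with h | rfl | h
    · exact key i k h
    · simp [halt]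
    · have := key k i h
      rw [hskew i k, neg_mul] at this
      rw [← neg_inj, ← this]
      abel

/-- The two words have the same sorting, so their defects must differ by the commutator of `e i` and
`e k` divided by t. Letters of `p` only multiply on the left, because the insertions that follow act
on equal sorted lists. -/
theorem sortDefect_swap (ht : ∀ x, t * x = x * t)
    (hκ : ∀ i j, e i * e j - e j * e i = t * κ i j)
    (hskew : ∀ i j, κ j i = - κ i j) (halt : ∀ i, κ i i = 0)
    (hjac : ∀ i j k, (κ i j * e k - e k * κ i j) + (κ j k * e i - e i * κ j k)
      + (κ k i * e j - e j * κ k i) = 0) (p s : List ι) (i k : ι) :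
    sortDefect e κ (p ++ i :: k :: s) - sortDefect e κ (p ++ k :: i :: s)
      = word e p * κ i k * word e s := by
  induction p with
  | nil =>
    have h1 := insertDefect_orderedInsert ht hκ hskew halt hjac i k (s.insertionSort (· ≤ ·))
      (List.pairwise_insertionSort _ _)
    have h2 : (e i * e k - e k * e i) * sortDefect e κ s
        = κ i k * (word e s - word e (s.insertionSort (· ≤ ·))) := by
      rw [hκ, ← mul_sortDefect ht hκ, ht, mul_assoc]
    simp only [List.nil_append, sortDefect, List.insertionSort_cons, word_nil]
    linear_combination (norm := noncomm_ring) h1 + h2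
  | cons j p ih =>
    have h : (p ++ i :: k :: s).insertionSort (· ≤ ·) = (p ++ k :: i :: s).insertionSort (· ≤ ·) :=
      insertionSort_eq_of_perm (List.Perm.append_left p (List.Perm.swap _ _ _))
    simp only [List.cons_append, sortDefect, word_cons, h]
    rw [add_sub_add_right_eq_sub, ← mul_sub, ih]
    noncomm_ring

end NormalOrdering

/-! ### Linear maps on crossed products and on quotient rings -/

theorem Module.Basis.induction_linear {R M ι : Type*} [Semiring R] [AddCommMonoid M] [Module R M]
    (b : Module.Basis ι R M) {p : M → Prop} (h0 : p 0) (hadd : ∀ x y, p x → p y → p (x + y))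
    (hsmul : ∀ (c : R) x, p x → p (c • x)) (hb : ∀ i, p (b i)) (x : M) : p x := by
  have hx : x ∈ Submodule.span R (Set.range b) := b.mem_span x
  induction hx using Submodule.span_induction with
  | mem x hx => obtain ⟨i, rfl⟩ := hx; exact hb i
  | zero => exact h0
  | add x y _ _ hx hy => exact hadd x y hx hy
  | smul c x _ hx => exact hsmul c x hx

/-- An additive map on a ring which respects all two-sided multiples of a relation is constant on
the fibres of the projection to the quotient. -/
theorem RingQuot.apply_eq_of_mkRingHom_eq {R M : Type*} [Ring R] [AddCommGroup M]
    {r : R → R → Prop} (L : R →+ M) (hL : ∀ x y, r x y → ∀ u z, L (u * x * z) = L (u * y * z))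
    {x y : R} (h : RingQuot.mkRingHom r x = RingQuot.mkRingHom r y) : L x = L y := by
  -- Carrying both multipliers `u` and `z` lets the induction pass through the closure of `r` under
  -- multiplication.
  have key : ∀ x y, RingQuot.Rel r x y → ∀ u z, L (u * x * z) = L (u * y * z) := by
    intro x y hxy
    induction hxy with
    | of h => exact hL _ _ h
    | add_left _ ih => intro u z; simp only [mul_add, add_mul, map_add, ih]
    | @mul_left a b c _ ih =>
      intro u z
      simpa only [mul_assoc] using ih u (c * z)
    | @mul_right a b c _ ih =>
      intro u z
      simpa only [mul_assoc] using ih (u * a) z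
  have key' : ∀ x y, RingQuot.Rel r x y → L x = L y := fun x y h => by
    simpa using key x y h 1 1
  rw [RingQuot.mkRingHom_def] at h
  have h' : Quot.mk (RingQuot.Rel r) x = Quot.mk (RingQuot.Rel r) y :=
    congrArg RingQuot.toQuot h
  exact congrArg (Quot.lift (fun x => L x) key') h'

namespace CrossedProduct

variable {G : Type*} [Group G] {S : Type*} [Ring S] [Algebra ℂ S]
  (φ : G →* (S →ₐ[ℂ] S)) (α : NormalizedTwoCocycle G)

/-- The linear map on `S #_α G` given by linear maps on the components `S ⊗ g`. -/
def liftLinear {M : Type*} [AddCommGroup M] [Module ℂ M] (L : G → S →ₗ[ℂ] M) :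
    CrossedProduct φ α →ₗ[ℂ] M :=
  Finsupp.lsum ℂ (M := S) L

@[simp] theorem liftLinear_of {M : Type*} [AddCommGroup M] [Module ℂ M] (L : G → S →ₗ[ℂ] M)
    (g : G) (s : S) : liftLinear φ α L (of φ α g s) = L g s :=
  Finsupp.lsum_single (R := ℂ) ℂ L g s

/-- The inclusion `S → S #_α G`. -/
def inclusion : S →ₐ[ℂ] CrossedProduct φ α :=
  AlgHom.ofLinearMap (of φ α 1) rfl fun x y => by simp [of_mul_of, α.one_left]

theorem inclusion_apply (s : S) : inclusion φ α s = of φ α 1 s := rfl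

theorem inclusion_mul_of_one (g : G) (s : S) : inclusion φ α s * of φ α g 1 = of φ α g s := by
  simp [inclusion_apply, of_mul_of, α.one_left]

theorem of_one_mul_inclusion (g : G) (s : S) :
    of φ α g 1 * inclusion φ α s = inclusion φ α (φ g s) * of φ α g 1 := by
  simp [inclusion_apply, of_mul_of, α.one_left, α.one_right]

theorem of_one_mul_of_one (g h : G) :
    of φ α g 1 * of φ α h 1 = (α g h : ℂ) • of φ α (g * h) 1 := by
  simp [of_mul_of]

end CrossedProduct

/-! ### The algebra `A`, its generators and its bracket -/

namespace TwistedHecke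

open CrossedProduct

variable {V : Type*} [AddCommGroup V] [Module ℂ V]
  {G : Subgroup (LinearMap.GeneralLinearGroup ℂ V)} (α : NormalizedTwoCocycle G)

@[simp] theorem tensorAction_ι (g : G) (v : V) :
    tensorAction G g (TensorAlgebra.ι ℂ v) = TensorAlgebra.ι ℂ (g • v) := by
  simp [tensorAction]
  rfl

variable (a : G → V →ₗ[ℂ] V →ₗ[ℂ] ℂ)

/-- The algebra `A`, as a type with its own ring and algebra structures. -/
def HeckeAlgebra : Type _ := HeckeQuotient α a

instance : Ring (HeckeAlgebra α a) := inferInstanceAs (Ring (HeckeQuotient α a))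

instance : Algebra ℂ[X] (HeckeAlgebra α a) :=
  inferInstanceAs (Algebra ℂ[X] (HeckeQuotient α a))

instance : Algebra ℂ (HeckeAlgebra α a) := Algebra.compHom _ (algebraMap ℂ ℂ[X])

instance : IsScalarTower ℂ ℂ[X] (HeckeAlgebra α a) := .of_algebraMap_eq fun _ => rfl

/-- The projection `T(V) #_α G [t] → A`. -/
def heckeMk : TensorCrossedPoly α →ₐ[ℂ[X]] HeckeAlgebra α a :=
  RingQuot.mkAlgHom ℂ[X] (Rel α a)

/-- The homomorphism `T(V) #_α G → A`. -/
def crossedHom : TensorCrossed α →ₐ[ℂ] HeckeAlgebra α a :=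
  ((heckeMk α a).restrictScalars ℂ).comp Algebra.TensorProduct.includeRight

/-- The homomorphism `T(V) → A`. -/
def tensorHom : TensorAlgebra ℂ V →ₐ[ℂ] HeckeAlgebra α a :=
  (crossedHom α a).comp (inclusion _ α)

/-- The image of `ḡ` in `A`. -/
def bar (g : G) : HeckeAlgebra α a := crossedHom α a (of _ α g 1)

theorem mkAlgHom_tmul (p : ℂ[X]) (x : TensorCrossed α) :
    heckeMk α a (p ⊗ₜ x) = p • crossedHom α a x := by
  have h : (p ⊗ₜ[ℂ] x : TensorCrossedPoly α) = p • ((1 : ℂ[X]) ⊗ₜ[ℂ] x) := by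
    rw [TensorProduct.smul_tmul', smul_eq_mul, mul_one]
  rw [h, map_smul]
  rfl

theorem crossedHom_of (g : G) (x : TensorAlgebra ℂ V) :
    crossedHom α a (of _ α g x) = tensorHom α a x * bar α a g := by
  rw [← inclusion_mul_of_one, map_mul]
  rfl

theorem bar_mul_tensorHom (g : G) (x : TensorAlgebra ℂ V) :
    bar α a g * tensorHom α a x = tensorHom α a (tensorAction G g x) * bar α a g := by
  have h := congrArg (crossedHom α a) (of_one_mul_inclusion (tensorAction G) α g x)
  rwa [map_mul, map_mul] at h

theorem bar_mul_bar (g h : G) : bar α a g * bar α a h = (α g h : ℂ) • bar α a (g * h) := by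
  have h := congrArg (crossedHom α a) (of_one_mul_of_one (tensorAction G) α g h)
  rwa [map_mul, map_smul] at h

theorem sum_tBar [Fintype G] (v w : V) :
    ∑ᶠ g : G, a g v w • tBar α g
      = (Polynomial.X : ℂ[X]) ⊗ₜ[ℂ] ∑ g : G, a g v w • of (tensorAction G) α g 1 := by
  rw [finsum_eq_sum_of_fintype, TensorProduct.tmul_sum]
  simp only [TensorProduct.tmul_smul]
  rfl

variable [Finite G]

/-- The bilinear map `κ(v, w) = ∑ g, a_g(v, w) ḡ` with values in `A`. -/
def bracketForm : V →ₗ[ℂ] V →ₗ[ℂ] HeckeAlgebra α a :=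
  letI := Fintype.ofFinite G
  ∑ g : G, (a g).compr₂ (LinearMap.toSpanSingleton ℂ _ (bar α a g))

theorem bracketForm_apply [Fintype G] (v w : V) :
    bracketForm α a v w = ∑ g : G, a g v w • bar α a g := by
  simp only [bracketForm, LinearMap.sum_apply, LinearMap.compr₂_apply,
    LinearMap.toSpanSingleton_apply]
  congr!

theorem tensorHom_bracket (v w : V) :
    tensorHom α a (TensorAlgebra.ι ℂ v) * tensorHom α a (TensorAlgebra.ι ℂ w)
      - tensorHom α a (TensorAlgebra.ι ℂ w) * tensorHom α a (TensorAlgebra.ι ℂ v)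
      = (Polynomial.X : ℂ[X]) • bracketForm α a v w := by
  cases nonempty_fintype G
  have h : heckeMk α a _ = heckeMk α a _ :=
    RingQuot.mkAlgHom_rel ℂ[X] (Rel.bracket (α := α) (a := a) v w)
  have hv : ∀ v, heckeMk α a (vec α v)
      = tensorHom α a (TensorAlgebra.ι ℂ v) := fun v => by
    rw [vec, mkAlgHom_tmul, one_smul]; rfl
  rw [sum_tBar, mkAlgHom_tmul, map_sub, map_mul, map_mul, hv, hv, map_sum] at h
  rw [h, bracketForm_apply]
  simp only [map_smul, bar]

end TwistedHecke

/-! ### Admissible families and the identities they give in `A` -/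

namespace TwistedHecke

open CrossedProduct

variable {V : Type*} [AddCommGroup V] [Module ℂ V]
  {G : Subgroup (LinearMap.GeneralLinearGroup ℂ V)}

/-- The conditions on the forms `a_g` for the quotient algebra to be a twisted graded Hecke
algebra: skew-symmetry, compatibility with conjugation, and the Jacobi identity. -/
structure IsAdmissible (α : NormalizedTwoCocycle G) (a : G → V →ₗ[ℂ] V →ₗ[ℂ] ℂ) : Prop where
  skew : ∀ g, IsSkew (a g)
  conj : ∀ (h k : G) (v w : V),
    a k v w * (α h k : ℂ) = a (h * k * h⁻¹) (h • v) (h • w) * (α (h * k * h⁻¹) h : ℂ)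
  jacobi : ∀ (k : G) (u v w : V),
    a k u v • (k • w - w) + a k v w • (k • u - u) + a k w u • (k • v - v) = 0

section Relations

theorem X_smul_one_comm {α : NormalizedTwoCocycle G} {a : G → V →ₗ[ℂ] V →ₗ[ℂ] ℂ}
    (x : HeckeAlgebra α a) :
    ((Polynomial.X : ℂ[X]) • (1 : HeckeAlgebra α a)) * x
      = x * ((Polynomial.X : ℂ[X]) • (1 : HeckeAlgebra α a)) := by
  simp

variable [Finite G] {α : NormalizedTwoCocycle G} {a : G → V →ₗ[ℂ] V →ₗ[ℂ] ℂ}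

theorem bracketForm_swap (h : ∀ g, IsSkew (a g)) (v w : V) :
    bracketForm α a w v = - bracketForm α a v w := by
  cases nonempty_fintype G
  simp only [bracketForm_apply, ← Finset.sum_neg_distrib]
  exact Finset.sum_congr rfl fun g _ => by rw [h g w v, neg_smul]

theorem bracketForm_self (h : ∀ g, IsSkew (a g)) (v : V) : bracketForm α a v v = 0 := by
  cases nonempty_fintype G
  rw [bracketForm_apply]
  exact Finset.sum_eq_zero fun g _ => by rw [self_eq_neg.1 (h g v v), zero_smul]

/-- Conjugation compatibility says that κ = ∑ a_k k̄ is equivariant under conjugation by h̄; the sum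
is reindexed by k ↦ h k h⁻¹. -/
theorem bar_mul_bracketForm
    (hc : ∀ (h k : G) (v w : V),
      a k v w * (α h k : ℂ) = a (h * k * h⁻¹) (h • v) (h • w) * (α (h * k * h⁻¹) h : ℂ))
    (h : G) (v w : V) :
    bar α a h * bracketForm α a v w = bracketForm α a (h • v) (h • w) * bar α a h := by
  cases nonempty_fintype G
  simp only [bracketForm_apply, Finset.mul_sum, Finset.sum_mul, mul_smul_comm, smul_mul_assoc,
    bar_mul_bar, smul_smul]
  refine Fintype.sum_equiv (MulAut.conj h).toEquiv _ _ fun k => ?_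
  simp only [MulEquiv.toEquiv_eq_coe, EquivLike.coe_coe, MulAut.conj_apply]
  rw [hc h k v w, inv_mul_cancel_right]

/-- Moving `w` to the left of k̄ turns it into `k • w`. This is the source of the differences `k • w
- w` in the Jacobi condition. -/
theorem bracketForm_commutator [Fintype G] (u v w : V) :
    bracketForm α a u v * tensorHom α a (TensorAlgebra.ι ℂ w)
      - tensorHom α a (TensorAlgebra.ι ℂ w) * bracketForm α a u v
      = ∑ k : G, tensorHom α a (TensorAlgebra.ι ℂ (a k u v • (k • w - w))) * bar α a k := by
  simp only [bracketForm_apply, Finset.sum_mul, Finset.mul_sum, smul_mul_assoc, mul_smul_comm,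
    bar_mul_tensorHom, tensorAction_ι, ← Finset.sum_sub_distrib]
  refine Finset.sum_congr rfl fun k _ => ?_
  rw [map_smul _ (a k u v), map_smul _ (a k u v), map_sub, map_sub, smul_mul_assoc, sub_mul, smul_sub]

theorem bracketForm_jacobi
    (hj : ∀ (k : G) (u v w : V),
      a k u v • (k • w - w) + a k v w • (k • u - u) + a k w u • (k • v - v) = 0) (u v w : V) :
    (bracketForm α a u v * tensorHom α a (TensorAlgebra.ι ℂ w)
      - tensorHom α a (TensorAlgebra.ι ℂ w) * bracketForm α a u v)
    + (bracketForm α a v w * tensorHom α a (TensorAlgebra.ι ℂ u)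
      - tensorHom α a (TensorAlgebra.ι ℂ u) * bracketForm α a v w)
    + (bracketForm α a w u * tensorHom α a (TensorAlgebra.ι ℂ v)
      - tensorHom α a (TensorAlgebra.ι ℂ v) * bracketForm α a w u) = 0 := by
  cases nonempty_fintype G
  rw [bracketForm_commutator, bracketForm_commutator, bracketForm_commutator,
    ← Finset.sum_add_distrib, ← Finset.sum_add_distrib]
  refine Finset.sum_eq_zero fun k _ => ?_
  rw [← add_mul, ← add_mul, ← map_add, ← map_add, ← map_add, ← map_add, hj, map_zero, map_zero,
    zero_mul]

end Relations

/-! ### Words in a basis of `V` -/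

section Words

variable {n : ℕ} (b : Module.Basis (Fin n) ℂ V)

theorem basis_tensorAlgebra_apply (l : List (Fin n)) :
    b.tensorAlgebra (FreeMonoid.ofList l)
      = NormalOrdering.word (fun i => TensorAlgebra.ι ℂ (b i)) l := by
  have h : FreeAlgebra.basisFreeMonoid ℂ (Fin n) (FreeMonoid.ofList l)
      = (l.map (FreeAlgebra.ι ℂ)).prod := by
    simp [FreeAlgebra.basisFreeMonoid, FreeAlgebra.equivMonoidAlgebraFreeMonoid]
  rw [Module.Basis.tensorAlgebra, Module.Basis.map_apply, h, AlgEquiv.toLinearEquiv_apply,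
    map_list_prod, List.map_map]
  simp [NormalOrdering.word, Function.comp_def]

theorem tensorHom_word [Finite G] (α : NormalizedTwoCocycle G) (a : G → V →ₗ[ℂ] V →ₗ[ℂ] ℂ)
    (l : List (Fin n)) :
    tensorHom α a (NormalOrdering.word (fun i => TensorAlgebra.ι ℂ (b i)) l)
      = NormalOrdering.word (fun i => tensorHom α a (TensorAlgebra.ι ℂ (b i))) l := by
  rw [NormalOrdering.word, NormalOrdering.word, map_list_prod, List.map_map]
  rfl

/-- The linear extension to `T(V)` of the quotient by `t` of the difference between a word in the
basis `b` and its sorting. -/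
def tensorDefect [Finite G] (α : NormalizedTwoCocycle G) (a : G → V →ₗ[ℂ] V →ₗ[ℂ] ℂ) :
    TensorAlgebra ℂ V →ₗ[ℂ] HeckeAlgebra α a :=
  b.tensorAlgebra.constr ℂ fun l => NormalOrdering.sortDefect
    (fun i => tensorHom α a (TensorAlgebra.ι ℂ (b i)))
    (fun i j => bracketForm α a (b i) (b j)) l.toList

variable [Finite G] {α : NormalizedTwoCocycle G} {a : G → V →ₗ[ℂ] V →ₗ[ℂ] ℂ}

theorem tensorDefect_word (l : List (Fin n)) :
    tensorDefect b α a (NormalOrdering.word (fun i => TensorAlgebra.ι ℂ (b i)) l)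
      = NormalOrdering.sortDefect (fun i => tensorHom α a (TensorAlgebra.ι ℂ (b i)))
        (fun i j => bracketForm α a (b i) (b j)) l := by
  rw [← basis_tensorAlgebra_apply, tensorDefect, Module.Basis.constr_basis]
  rfl

theorem X_smul_tensorDefect_word (l : List (Fin n)) :
    (Polynomial.X : ℂ[X]) • tensorDefect b α a
        (NormalOrdering.word (fun i => TensorAlgebra.ι ℂ (b i)) l)
      = tensorHom α a (NormalOrdering.word (fun i => TensorAlgebra.ι ℂ (b i)) l)
        - tensorHom α a (NormalOrdering.word (fun i => TensorAlgebra.ι ℂ (b i))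
          (l.insertionSort (· ≤ ·))) := by
  rw [tensorDefect_word, tensorHom_word, tensorHom_word,
    ← NormalOrdering.mul_sortDefect (κ := fun i j => bracketForm α a (b i) (b j))
      X_smul_one_comm (fun i j => by rw [tensorHom_bracket, smul_one_mul]), smul_one_mul]

/-- By multilinearity all arguments may be taken from the bases, and the claim becomes
`sortDefect_swap`. It says that dividing by t turns [v, w] into κ(v, w), as the defining relation
requires. -/
theorem tensorDefect_bracket (h : IsAdmissible α a) (x y : TensorAlgebra ℂ V) (v w : V) :
    tensorDefect b α a (x * (TensorAlgebra.ι ℂ v * TensorAlgebra.ι ℂ w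
        - TensorAlgebra.ι ℂ w * TensorAlgebra.ι ℂ v) * y)
      = tensorHom α a x * bracketForm α a v w * tensorHom α a y := by
  induction x using b.tensorAlgebra.induction_linear with
  | h0 => simp
  | hadd x x' hx hx' => simp only [add_mul, map_add, hx, hx']
  | hsmul c x hx => simp only [smul_mul_assoc, map_smul, hx]
  | hb p =>
  induction y using b.tensorAlgebra.induction_linear with
  | h0 => simp
  | hadd x x' hx hx' => simp only [mul_add, map_add, hx, hx']
  | hsmul c x hx => simp only [mul_smul_comm, map_smul, hx]
  | hb s =>
  induction v using b.induction_linear with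
  | h0 => simp
  | hadd x x' hx hx' =>
    rw [map_add (bracketForm α a), LinearMap.add_apply, mul_add, add_mul, ← hx, ← hx', ← map_add,
      map_add (TensorAlgebra.ι ℂ)]
    congr 1
    noncomm_ring
  | hsmul c x hx =>
    simp only [mul_smul_comm, smul_mul_assoc, map_smul, LinearMap.smul_apply, ← smul_sub, hx]
  | hb i =>
  induction w using b.induction_linear with
  | h0 => simp
  | hadd x x' hx hx' =>
    rw [map_add (bracketForm α a _), mul_add, add_mul, ← hx, ← hx', ← map_add,
      map_add (TensorAlgebra.ι ℂ)]
    congr 1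
    noncomm_ring
  | hsmul c x hx =>
    simp only [mul_smul_comm, smul_mul_assoc, map_smul, ← smul_sub, hx]
  | hb k =>
  have key := NormalOrdering.sortDefect_swap
    (e := fun i => tensorHom α a (TensorAlgebra.ι ℂ (b i)))
    (κ := fun i j => bracketForm α a (b i) (b j))
    X_smul_one_comm (fun i j => by rw [tensorHom_bracket, smul_one_mul])
    (fun i j => bracketForm_swap h.skew _ _) (fun i => bracketForm_self h.skew _)
    (fun i j k => bracketForm_jacobi h.jacobi _ _ _) p.toList s.toList i k
  have hp := basis_tensorAlgebra_apply b p.toList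
  have hs := basis_tensorAlgebra_apply b s.toList
  rw [FreeMonoid.ofList_toList] at hp hs
  rw [hp, hs, tensorHom_word, tensorHom_word, ← key, ← tensorDefect_word, ← tensorDefect_word,
    ← map_sub]
  congr 1
  simp only [NormalOrdering.word_append, NormalOrdering.word_cons]
  noncomm_ring

end Words

/-! ### Commutators of vectors in the crossed product -/

section Commutators

variable {α : NormalizedTwoCocycle G}

theorem inclusion_conj (g h : G) (r s x : TensorAlgebra ℂ V) :
    of (tensorAction G) α g r * inclusion _ α x * of _ α h s
      = (α g h : ℂ) • of _ α (g * h) (r * tensorAction G g x * tensorAction G g s) := by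
  rw [inclusion_apply, of_mul_of, smul_mul_assoc, of_mul_of, α.one_right, mul_one, Units.val_one,
    one_smul]

theorem tensorAction_bracket (g : G) (v w : V) :
    tensorAction G g (TensorAlgebra.ι ℂ v * TensorAlgebra.ι ℂ w
        - TensorAlgebra.ι ℂ w * TensorAlgebra.ι ℂ v)
      = TensorAlgebra.ι ℂ (g • v) * TensorAlgebra.ι ℂ (g • w)
        - TensorAlgebra.ι ℂ (g • w) * TensorAlgebra.ι ℂ (g • v) := by
  simp only [map_sub, map_mul, tensorAction_ι]

theorem vec_bracket (v w : V) :
    vec α v * vec α w - vec α w * vec α v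
      = (1 : ℂ[X]) ⊗ₜ[ℂ] inclusion (tensorAction G) α (TensorAlgebra.ι ℂ v * TensorAlgebra.ι ℂ w
        - TensorAlgebra.ι ℂ w * TensorAlgebra.ι ℂ v) := by
  simp only [vec, Algebra.TensorProduct.tmul_mul_tmul, ← inclusion_apply, ← map_mul, one_mul,
    ← TensorProduct.tmul_sub, ← map_sub]

end Commutators

end TwistedHecke

namespace TwistedHecke

open CrossedProduct

variable {V : Type*} [AddCommGroup V] [Module ℂ V]
  {G : Subgroup (LinearMap.GeneralLinearGroup ℂ V)}

/-! ### The indeterminate is not a zero divisor -/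

section TorsionFree

variable {n : ℕ} (b : Module.Basis (Fin n) ℂ V) [Finite G]

/-- The extension of `tensorDefect` to the crossed product. -/
def crossedDefect (α : NormalizedTwoCocycle G) (a : G → V →ₗ[ℂ] V →ₗ[ℂ] ℂ) :
    TensorCrossed α →ₗ[ℂ] HeckeAlgebra α a :=
  liftLinear _ α fun g => LinearMap.mulRight ℂ (bar α a g) ∘ₗ tensorDefect b α a

/-- The linear map `T(V) #_α G [t] → A` which is `crossedDefect` in degree `0` and division by `t`
in positive degrees. -/
def polyDefect (α : NormalizedTwoCocycle G) (a : G → V →ₗ[ℂ] V →ₗ[ℂ] ℂ) :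
    TensorCrossedPoly α →ₗ[ℂ] HeckeAlgebra α a :=
  TensorProduct.lift <| LinearMap.mk₂ ℂ
    (fun p x => p.coeff 0 • crossedDefect b α a x + p.divX • crossedHom α a x)
    (fun p q x => by simp only [Polynomial.coeff_add, Polynomial.divX_add, add_smul]; abel)
    (fun c p x => by
      have h : (c • p).divX = c • p.divX := by ext; simp [Polynomial.coeff_divX]
      simp only [Polynomial.coeff_smul, smul_eq_mul, mul_smul, smul_add, h, smul_assoc])
    (fun p x y => by simp only [map_add, smul_add]; abel)
    (fun c p x => by
      simp only [map_smul, smul_add, smul_comm c])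

variable {α : NormalizedTwoCocycle G} {a : G → V →ₗ[ℂ] V →ₗ[ℂ] ℂ}

theorem polyDefect_tmul (p : ℂ[X]) (x : TensorCrossed α) :
    polyDefect b α a (p ⊗ₜ x) = p.coeff 0 • crossedDefect b α a x + p.divX • crossedHom α a x :=
  rfl

/-- Once `polyDefect` is known to respect the relations, this makes the induced map on `A` a left
inverse of multiplication by t. -/
theorem polyDefect_X_smul (u : TensorCrossedPoly α) :
    polyDefect b α a ((Polynomial.X : ℂ[X]) • u) = heckeMk α a u := by
  induction u using TensorProduct.induction_on with
  | zero => simp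
  | add u v hu hv => simp only [smul_add, map_add, hu, hv]
  | tmul p x =>
    have h : ((Polynomial.X : ℂ[X]) * p).divX = p := by ext; simp [Polynomial.coeff_divX]
    rw [TensorProduct.smul_tmul', polyDefect_tmul, mkAlgHom_tmul, smul_eq_mul, h]
    simp

/-- The group part of `x` must be carried past the bracket, turning [v, w] into [gv, gw];
equivariance of κ undoes this on the other side. -/
theorem crossedDefect_bracket (h : IsAdmissible α a) (x y : TensorCrossed α) (v w : V) :
    crossedDefect b α a (x * inclusion _ α (TensorAlgebra.ι ℂ v * TensorAlgebra.ι ℂ w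
        - TensorAlgebra.ι ℂ w * TensorAlgebra.ι ℂ v) * y)
      = crossedHom α a x * bracketForm α a v w * crossedHom α a y := by
  induction x using CrossedProduct.induction with
  | h0 => simp
  | hadd x x' hx hx' => simp only [add_mul, map_add, hx, hx']
  | hof g r =>
  induction y using CrossedProduct.induction with
  | h0 => simp
  | hadd x x' hx hx' => simp only [mul_add, map_add, hx, hx']
  | hof k s =>
  rw [inclusion_conj, map_smul, crossedDefect, liftLinear_of, tensorAction_bracket,
    LinearMap.comp_apply, LinearMap.mulRight_apply, tensorDefect_bracket b h, crossedHom_of,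
    crossedHom_of, ← mul_smul_comm, ← bar_mul_bar, mul_assoc _ (bar α a g),
    bar_mul_bracketForm h.conj]
  simp only [mul_assoc]
  rw [← mul_assoc (bar α a g), bar_mul_tensorHom]
  simp only [mul_assoc]

theorem polyDefect_rel (h : IsAdmissible α a) {x y : TensorCrossedPoly α} (hxy : Rel α a x y)
    (u z : TensorCrossedPoly α) :
    polyDefect b α a (u * x * z) = polyDefect b α a (u * y * z) := by
  cases nonempty_fintype G
  obtain ⟨v, w⟩ := hxy
  rw [vec_bracket, sum_tBar]
  induction u using TensorProduct.induction_on with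
  | zero => simp
  | add u u' hu hu' => simp only [add_mul, map_add, hu, hu']
  | tmul p r =>
  induction z using TensorProduct.induction_on with
  | zero => simp
  | add u u' hu hu' => simp only [mul_add, map_add, hu, hu']
  | tmul q s =>
  simp only [Algebra.TensorProduct.tmul_mul_tmul, mul_one]
  have hX : (p * Polynomial.X * q) ⊗ₜ[ℂ] (r * (∑ g : G, a g v w • of (tensorAction G) α g 1) * s)
      = (Polynomial.X : ℂ[X]) • ((p * q) ⊗ₜ[ℂ]
        (r * (∑ g : G, a g v w • of (tensorAction G) α g 1) * s)) := by
    rw [TensorProduct.smul_tmul', smul_eq_mul]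
    congr 1
    ring
  have hb : crossedHom α a (∑ g : G, a g v w • of (tensorAction G) α g 1)
      = bracketForm α a v w := by
    rw [bracketForm_apply, map_sum]
    simp only [map_smul, bar]
  have hbr : crossedHom α a (inclusion _ α (TensorAlgebra.ι ℂ v * TensorAlgebra.ι ℂ w
        - TensorAlgebra.ι ℂ w * TensorAlgebra.ι ℂ v))
      = (Polynomial.X : ℂ[X]) • bracketForm α a v w := by
    rw [← tensorHom_bracket, ← map_mul (tensorHom α a), ← map_mul (tensorHom α a), ← map_sub]
    rfl
  rw [hX, polyDefect_X_smul, mkAlgHom_tmul, polyDefect_tmul, crossedDefect_bracket b h, map_mul,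
    map_mul, map_mul, map_mul, hb, hbr, mul_smul_comm, smul_mul_assoc]
  -- The constant term of `p * q` is accounted for by `crossedDefect`, and the part divisible by t
  -- by the relation already valid in `A`.
  conv_rhs => rw [← Polynomial.divX_mul_X_add (p * q)]
  rw [add_smul, mul_smul, add_comm, ← Polynomial.algebraMap_eq, algebraMap_smul]

theorem eq_zero_of_X_smul_eq_zero [FiniteDimensional ℂ V] (h : IsAdmissible α a)
    {x : HeckeAlgebra α a} (hx : (Polynomial.X : ℂ[X]) • x = 0) : x = 0 := by
  let b := Module.finBasis ℂ V
  obtain ⟨u, rfl⟩ := RingQuot.mkAlgHom_surjective ℂ[X] (Rel α a) x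
  change heckeMk α a u = 0
  have hx' : RingQuot.mkAlgHom ℂ[X] (Rel α a) ((Polynomial.X : ℂ[X]) • u)
      = RingQuot.mkAlgHom ℂ[X] (Rel α a) 0 := by
    rw [map_smul, map_zero]
    exact hx
  have hc := RingQuot.mkAlgHom_coe ℂ[X] (Rel α a)
  have := RingQuot.apply_eq_of_mkRingHom_eq (polyDefect b α a).toAddMonoidHom
    (fun _ _ hxy u z => polyDefect_rel b h hxy u z)
    (((DFunLike.congr_fun hc _).symm.trans hx').trans (DFunLike.congr_fun hc _))
  rw [← polyDefect_X_smul b]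
  simpa using this

end TorsionFree

/-! ### Injectivity -/

section Injective

variable [Finite G] {α : NormalizedTwoCocycle G} {a : G → V →ₗ[ℂ] V →ₗ[ℂ] ℂ}

/-- The projection `T(V) #_α G → S(V) ⊗ ℂG`. -/
def crossedSymm (α : NormalizedTwoCocycle G) :
    TensorCrossed α →ₗ[ℂ] (G →₀ SymmetricAlgebra ℂ V) :=
  liftLinear _ α fun g => Finsupp.lsingle g ∘ₗ (SymmetricAlgebra.algHom ℂ V).toLinearMap

/-- The projection `T(V) #_α G [t] → S(V) ⊗ ℂG` sending `t` to `0`. -/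
def polySymm (α : NormalizedTwoCocycle G) :
    TensorCrossedPoly α →ₗ[ℂ] (G →₀ SymmetricAlgebra ℂ V) :=
  TensorProduct.lift <| LinearMap.mk₂ ℂ (fun p x => p.coeff 0 • crossedSymm α x)
    (fun p q x => by simp only [Polynomial.coeff_add, add_smul])
    (fun c p x => by simp only [Polynomial.coeff_smul, smul_eq_mul, mul_smul])
    (fun p x y => by simp only [map_add, smul_add])
    (fun c p x => by simp only [map_smul, smul_comm c])

theorem polySymm_tmul (p : ℂ[X]) (x : TensorCrossed α) :
    polySymm α (p ⊗ₜ x) = p.coeff 0 • crossedSymm α x := rfl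

theorem crossedSymm_bracket (x y : TensorCrossed α) (v w : V) :
    crossedSymm α (x * inclusion _ α (TensorAlgebra.ι ℂ v * TensorAlgebra.ι ℂ w
        - TensorAlgebra.ι ℂ w * TensorAlgebra.ι ℂ v) * y) = 0 := by
  induction x using CrossedProduct.induction with
  | h0 => simp
  | hadd x x' hx hx' => simp only [add_mul, map_add, hx, hx', add_zero]
  | hof g r =>
  induction y using CrossedProduct.induction with
  | h0 => simp
  | hadd x x' hx hx' => simp only [mul_add, map_add, hx, hx', add_zero]
  | hof k s =>
  rw [inclusion_conj, map_smul, crossedSymm, liftLinear_of, tensorAction_bracket,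
    LinearMap.comp_apply, AlgHom.toLinearMap_apply]
  have h : SymmetricAlgebra.algHom ℂ V (r * (TensorAlgebra.ι ℂ (g • v) * TensorAlgebra.ι ℂ (g • w)
      - TensorAlgebra.ι ℂ (g • w) * TensorAlgebra.ι ℂ (g • v)) * tensorAction G g s) = 0 := by
    simp only [map_mul, map_sub]
    ring
  rw [h, map_zero, smul_zero]

/-- At t = 0 both sides vanish: the commutator because S(V) is commutative, the other side because
of its factor t. No condition on the forms is needed, nor a product on the target. -/
theorem polySymm_rel {x y : TensorCrossedPoly α} (hxy : Rel α a x y)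
    (u z : TensorCrossedPoly α) : polySymm α (u * x * z) = polySymm α (u * y * z) := by
  cases nonempty_fintype G
  obtain ⟨v, w⟩ := hxy
  rw [vec_bracket, sum_tBar]
  induction u using TensorProduct.induction_on with
  | zero => simp
  | add u u' hu hu' => simp only [add_mul, map_add, hu, hu']
  | tmul p r =>
  induction z using TensorProduct.induction_on with
  | zero => simp
  | add u u' hu hu' => simp only [mul_add, map_add, hu, hu']
  | tmul q s =>
  simp only [Algebra.TensorProduct.tmul_mul_tmul, polySymm_tmul, crossedSymm_bracket,
    Polynomial.mul_coeff_zero, Polynomial.coeff_X_zero, mul_zero, zero_mul, zero_smul, smul_zero]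

theorem polySymm_eq_zero {u : TensorCrossedPoly α} (hu : heckeMk α a u = 0) :
    polySymm α u = 0 := by
  have hc := RingQuot.mkAlgHom_coe ℂ[X] (Rel α a)
  have hx' : RingQuot.mkAlgHom ℂ[X] (Rel α a) u = RingQuot.mkAlgHom ℂ[X] (Rel α a) 0 := by
    rw [map_zero]
    exact hu
  have := RingQuot.apply_eq_of_mkRingHom_eq (polySymm α).toAddMonoidHom
    (fun _ _ hxy u z => polySymm_rel hxy u z)
    (((DFunLike.congr_fun hc _).symm.trans hx').trans (DFunLike.congr_fun hc _))
  simpa using this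

/-- The coefficient of `t ^ j` of an element of `W [t]`. -/
def tensorCoeff (W : Type*) [AddCommGroup W] [Module ℂ W] (j : ℕ) : ℂ[X] ⊗[ℂ] W →ₗ[ℂ] W :=
  TensorProduct.lift ((LinearMap.lsmul ℂ W).comp (Polynomial.lcoeff ℂ j))

section Coeff

variable {W : Type*} [AddCommGroup W] [Module ℂ W]

@[simp] theorem tensorCoeff_tmul (j : ℕ) (p : ℂ[X]) (x : W) :
    tensorCoeff W j (p ⊗ₜ x) = p.coeff j • x := rfl

theorem tensorCoeff_succ_X_smul (j : ℕ) (u : ℂ[X] ⊗[ℂ] W) :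
    tensorCoeff W (j + 1) ((Polynomial.X : ℂ[X]) • u) = tensorCoeff W j u := by
  induction u using TensorProduct.induction_on with
  | zero => simp
  | add u u' hu hu' => simp only [smul_add, map_add, hu, hu']
  | tmul p x =>
    rw [TensorProduct.smul_tmul', smul_eq_mul, tensorCoeff_tmul, tensorCoeff_tmul,
      Polynomial.coeff_X_mul]

theorem exists_X_smul_of_tensorCoeff_zero {u : ℂ[X] ⊗[ℂ] W} (hu : tensorCoeff W 0 u = 0) :
    ∃ v, u = (Polynomial.X : ℂ[X]) • v := by
  have key : ∀ u : ℂ[X] ⊗[ℂ] W,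
      ∃ v, u = (1 : ℂ[X]) ⊗ₜ tensorCoeff W 0 u + (Polynomial.X : ℂ[X]) • v := by
    intro u
    induction u using TensorProduct.induction_on with
    | zero => exact ⟨0, by simp⟩
    | add u u' hu hu' =>
      obtain ⟨v, hv⟩ := hu
      obtain ⟨v', hv'⟩ := hu'
      refine ⟨v + v', ?_⟩
      rw [map_add, TensorProduct.tmul_add, smul_add, add_add_add_comm, ← hv, ← hv']
    | tmul p x =>
      refine ⟨p.divX ⊗ₜ x, ?_⟩
      rw [tensorCoeff_tmul, ← TensorProduct.smul_tmul, TensorProduct.smul_tmul', smul_eq_mul,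
        ← TensorProduct.add_tmul, mul_comm, add_comm, ← Polynomial.C_1, Polynomial.smul_C,
        smul_eq_mul, mul_one, Polynomial.divX_mul_X_add]
  obtain ⟨v, hv⟩ := key u
  exact ⟨v, by rw [hv, hu, TensorProduct.tmul_zero, zero_add]⟩

theorem eq_zero_of_tensorCoeff {u : ℂ[X] ⊗[ℂ] W} (hu : ∀ j, tensorCoeff W j u = 0) : u = 0 := by
  let e := TensorProduct.equivFinsuppOfBasisLeft (N := W) (Polynomial.basisMonomials ℂ)
  have he : ∀ (u : ℂ[X] ⊗[ℂ] W) j, e u j = tensorCoeff W j u := by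
    intro u j
    induction u using TensorProduct.induction_on with
    | zero => simp
    | add u u' hu hu' => rw [map_add, map_add, Finsupp.add_apply, hu, hu']
    | tmul p x =>
      simp only [e, TensorProduct.equivFinsuppOfBasisLeft_apply_tmul_apply, tensorCoeff_tmul]
      rfl
  apply e.injective
  ext j : 1
  rw [he, hu, map_zero, Finsupp.zero_apply]

end Coeff

/-- The map `pbwMap` before passing to the quotient. -/
def pbwLift (α : NormalizedTwoCocycle G) (σ : GradedSection V) :
    (G →₀ SymmetricAlgebra ℂ V) →ₗ[ℂ] TensorCrossed α :=
  Finsupp.mapRange.linearMap σ.toLin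

theorem pbwLift_single (σ : GradedSection V) (g : G) (s : SymmetricAlgebra ℂ V) :
    pbwLift α σ (Finsupp.single g s) = of _ α g (σ.toLin s) :=
  Finsupp.mapRange_single (hf := map_zero _)

/-- The map `pbwMap` with values in `HeckeAlgebra`. -/
def pbwHecke (α : NormalizedTwoCocycle G) (a : G → V →ₗ[ℂ] V →ₗ[ℂ] ℂ) (σ : GradedSection V) :
    ℂ[X] ⊗[ℂ] (G →₀ SymmetricAlgebra ℂ V) →ₗ[ℂ[X]] HeckeAlgebra α a :=
  (heckeMk α a).toLinearMap ∘ₗ (pbwLift α σ).baseChange ℂ[X]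

theorem coe_pbwMap (σ : GradedSection V) : ⇑(pbwMap α a σ) = ⇑(pbwHecke α a σ) := rfl

theorem pbwHecke_tmul (σ : GradedSection V) (p : ℂ[X]) (x : G →₀ SymmetricAlgebra ℂ V) :
    pbwHecke α a σ (p ⊗ₜ x) = p • crossedHom α a (pbwLift α σ x) :=
  mkAlgHom_tmul α a p (pbwLift α σ x)

theorem polySymm_pbwLift (σ : GradedSection V) (u : ℂ[X] ⊗[ℂ] (G →₀ SymmetricAlgebra ℂ V)) :
    polySymm α ((pbwLift α σ).baseChange ℂ[X] u) = tensorCoeff _ 0 u := by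
  induction u using TensorProduct.induction_on with
  | zero => simp
  | add u u' hu hu' => rw [map_add, map_add, map_add, hu, hu']
  | tmul p x =>
    rw [LinearMap.baseChange_tmul, polySymm_tmul, tensorCoeff_tmul]
    congr 1
    induction x using Finsupp.induction_linear with
    | zero => simp
    | add x y hx hy => rw [map_add, map_add, hx, hy]
    | single g s =>
      rw [pbwLift_single, crossedSymm, liftLinear_of, LinearMap.comp_apply,
        AlgHom.toLinearMap_apply, σ.section_apply]
      rfl

/-- Reduction modulo t (`polySymm`) kills the constant coefficient of a kernel element; the
remaining factor t may be cancelled in `A`, which lowers the index of the next coefficient. -/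
theorem pbwHecke_injective [FiniteDimensional ℂ V] (h : IsAdmissible α a) (σ : GradedSection V) :
    Function.Injective (pbwHecke α a σ) := by
  have key : ∀ (j : ℕ) (u : ℂ[X] ⊗[ℂ] (G →₀ SymmetricAlgebra ℂ V)), pbwHecke α a σ u = 0 →
      tensorCoeff _ j u = 0 := by
    intro j
    induction j with
    | zero =>
      intro u hu
      rw [← polySymm_pbwLift (α := α) σ]
      exact polySymm_eq_zero hu
    | succ j ih =>
      intro u hu
      have h0 : tensorCoeff _ 0 u = 0 := by
        rw [← polySymm_pbwLift (α := α) σ]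
        exact polySymm_eq_zero hu
      obtain ⟨v, rfl⟩ := exists_X_smul_of_tensorCoeff_zero h0
      rw [tensorCoeff_succ_X_smul]
      refine ih v (eq_zero_of_X_smul_eq_zero h ?_)
      rw [map_smul] at hu
      exact hu
  rw [injective_iff_map_eq_zero]
  exact fun u hu => eq_zero_of_tensorCoeff fun j => key j u hu

end Injective

end TwistedHecke

namespace TwistedHecke

open CrossedProduct

variable {V : Type*} [AddCommGroup V] [Module ℂ V]
  {G : Subgroup (LinearMap.GeneralLinearGroup ℂ V)}

/-! ### Surjectivity -/

section Surjective

variable (V) in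
/-- The degree `n` part of `T(V)`. -/
abbrev tensorDegree (n : ℕ) : Submodule ℂ (TensorAlgebra ℂ V) :=
  LinearMap.range (TensorAlgebra.ι ℂ (M := V)) ^ n

theorem tensorAction_mem_tensorDegree (g : G) {n : ℕ} {x : TensorAlgebra ℂ V}
    (hx : x ∈ tensorDegree V n) : tensorAction G g x ∈ tensorDegree V n := by
  have h1 : (LinearMap.range (TensorAlgebra.ι ℂ (M := V))).map (tensorAction G g).toLinearMap
      ≤ LinearMap.range (TensorAlgebra.ι ℂ (M := V)) := by
    rintro _ ⟨_, ⟨v, rfl⟩, rfl⟩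
    exact ⟨g • v, (tensorAction_ι g v).symm⟩
  have h2 := Submodule.mem_map_of_mem (f := (tensorAction G g).toLinearMap) hx
  rw [Submodule.map_pow] at h2
  exact pow_le_pow_left' h1 n h2

theorem ι_mul_mem_tensorDegree (v : V) {n : ℕ} {x : TensorAlgebra ℂ V}
    (hx : x ∈ tensorDegree V n) : TensorAlgebra.ι ℂ v * x ∈ tensorDegree V (n + 1) := by
  rw [tensorDegree, pow_succ']
  exact Submodule.mul_mem_mul (LinearMap.mem_range_self _ v) hx

variable [Finite G] (α : NormalizedTwoCocycle G) (a : G → V →ₗ[ℂ] V →ₗ[ℂ] ℂ)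

/-- The span of the products in `A` of elements of `T(V)` of degree less than `n` and elements
of `G`. -/
def degreeLT (n : ℕ) : Submodule ℂ (HeckeAlgebra α a) :=
  Submodule.span ℂ {z | ∃ m < n, ∃ x ∈ tensorDegree V m, ∃ g : G,
    z = tensorHom α a x * bar α a g}

variable {α a}

theorem tensorHom_mul_bar_mem_degreeLT {m n : ℕ} (h : m < n) {x : TensorAlgebra ℂ V}
    (hx : x ∈ tensorDegree V m) (g : G) : tensorHom α a x * bar α a g ∈ degreeLT α a n :=
  Submodule.subset_span ⟨m, h, x, hx, g, rfl⟩

theorem degreeLT_mono {m n : ℕ} (h : m ≤ n) : degreeLT α a m ≤ degreeLT α a n :=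
  Submodule.span_mono fun _ ⟨k, hk, hz⟩ => ⟨k, hk.trans_le h, hz⟩

theorem ι_mul_mem_degreeLT (v : V) {n : ℕ} {z : HeckeAlgebra α a} (hz : z ∈ degreeLT α a n) :
    tensorHom α a (TensorAlgebra.ι ℂ v) * z ∈ degreeLT α a (n + 1) := by
  induction hz using Submodule.span_induction with
  | mem z hz =>
    obtain ⟨m, hm, x, hx, g, rfl⟩ := hz
    rw [← mul_assoc, ← map_mul]
    exact tensorHom_mul_bar_mem_degreeLT (by omega) (ι_mul_mem_tensorDegree v hx) g
  | zero => rw [mul_zero]; exact Submodule.zero_mem _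
  | add y z _ _ hy hz => rw [mul_add]; exact Submodule.add_mem _ hy hz
  | smul c z _ hz => rw [mul_smul_comm]; exact Submodule.smul_mem _ _ hz

theorem mul_bar_mem_degreeLT (g : G) {n : ℕ} {z : HeckeAlgebra α a} (hz : z ∈ degreeLT α a n) :
    z * bar α a g ∈ degreeLT α a n := by
  induction hz using Submodule.span_induction with
  | mem z hz =>
    obtain ⟨m, hm, x, hx, h, rfl⟩ := hz
    rw [mul_assoc, bar_mul_bar, mul_smul_comm]
    exact Submodule.smul_mem _ _ (tensorHom_mul_bar_mem_degreeLT hm hx _)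
  | zero => rw [zero_mul]; exact Submodule.zero_mem _
  | add y z _ _ hy hz => rw [add_mul]; exact Submodule.add_mem _ hy hz
  | smul c z _ hz => rw [smul_mul_assoc]; exact Submodule.smul_mem _ _ hz

theorem bracketForm_mul_mem_degreeLT (v w : V) {m n : ℕ} (h : m < n) {x : TensorAlgebra ℂ V}
    (hx : x ∈ tensorDegree V m) :
    bracketForm α a v w * tensorHom α a x ∈ degreeLT α a n := by
  cases nonempty_fintype G
  rw [bracketForm_apply, Finset.sum_mul]
  refine Submodule.sum_mem _ fun g _ => ?_
  rw [smul_mul_assoc, bar_mul_tensorHom]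
  exact Submodule.smul_mem _ _
    (tensorHom_mul_bar_mem_degreeLT h (tensorAction_mem_tensorDegree g hx) g)

variable {n : ℕ} (b : Module.Basis (Fin n) ℂ V)

theorem word_mem_tensorDegree (l : List (Fin n)) :
    NormalOrdering.word (fun i => TensorAlgebra.ι ℂ (b i)) l ∈ tensorDegree V l.length := by
  induction l with
  | nil => simp
  | cons i l ih =>
    rw [NormalOrdering.word_cons]
    exact ι_mul_mem_tensorDegree _ ih

theorem insertDefect_mem_degreeLT (i : Fin n) (l : List (Fin n)) :
    NormalOrdering.insertDefect (fun i => tensorHom α a (TensorAlgebra.ι ℂ (b i)))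
      (fun i j => bracketForm α a (b i) (b j)) i l ∈ degreeLT α a l.length := by
  induction l with
  | nil => exact Submodule.zero_mem _
  | cons j l ih =>
    rw [NormalOrdering.insertDefect]
    split_ifs
    · exact Submodule.zero_mem _
    · rw [← tensorHom_word]
      exact Submodule.add_mem _
        (bracketForm_mul_mem_degreeLT _ _ (Nat.lt_succ_self _) (word_mem_tensorDegree b l))
        (ι_mul_mem_degreeLT _ ih)

theorem sortDefect_mem_degreeLT (l : List (Fin n)) :
    NormalOrdering.sortDefect (fun i => tensorHom α a (TensorAlgebra.ι ℂ (b i)))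
      (fun i j => bracketForm α a (b i) (b j)) l ∈ degreeLT α a l.length := by
  induction l with
  | nil => exact Submodule.zero_mem _
  | cons i l ih =>
    refine Submodule.add_mem _ (ι_mul_mem_degreeLT _ ih) (degreeLT_mono (Nat.le_succ _) ?_)
    have := insertDefect_mem_degreeLT (α := α) (a := a) b i (l.insertionSort (· ≤ ·))
    rwa [List.length_insertionSort] at this

open scoped Pointwise in
theorem tensorDegree_le_span_word (m : ℕ) :
    tensorDegree V m ≤ Submodule.span ℂ {x | ∃ l : List (Fin n), l.length = m ∧
      x = NormalOrdering.word (fun i => TensorAlgebra.ι ℂ (b i)) l} := by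
  have hT : LinearMap.range (TensorAlgebra.ι ℂ (M := V))
      = Submodule.span ℂ (Set.range fun i => TensorAlgebra.ι ℂ (b i)) := by
    rw [LinearMap.range_eq_map, ← b.span_eq, Submodule.map_span, ← Set.range_comp]
    rfl
  rw [tensorDegree, hT, Submodule.span_pow]
  refine Submodule.span_mono ?_
  induction m with
  | zero =>
    intro x hx
    rw [pow_zero, Set.mem_one] at hx
    exact ⟨[], rfl, hx⟩
  | succ m ih =>
    intro x hx
    rw [pow_succ', Set.mem_mul] at hx
    obtain ⟨_, ⟨i, rfl⟩, z, hz, rfl⟩ := hx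
    obtain ⟨l, hl, rfl⟩ := ih hz
    exact ⟨i :: l, by simp [hl], (NormalOrdering.word_cons _ _ _).symm⟩

/-- Each exchange of letters trades two vectors for group elements, so the degree really drops by
two; a strict drop is all that surjectivity needs. -/
theorem tensorDefect_mem_degreeLT {m : ℕ} {x : TensorAlgebra ℂ V} (hx : x ∈ tensorDegree V m) :
    tensorDefect b α a x ∈ degreeLT α a m := by
  have hx' := tensorDegree_le_span_word b m hx
  clear hx
  induction hx' using Submodule.span_induction with
  | mem x hx =>
    obtain ⟨l, rfl, rfl⟩ := hx
    rw [tensorDefect_word]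
    exact sortDefect_mem_degreeLT b l
  | zero => rw [map_zero]; exact Submodule.zero_mem _
  | add y z _ _ hy hz => rw [map_add]; exact Submodule.add_mem _ hy hz
  | smul c z _ hz => rw [map_smul]; exact Submodule.smul_mem _ _ hz

/-- Sorted words in a basis give a linear section of the projection `T(V) → S(V)`. -/
theorem exists_sortedSection : ∃ τ : SymmetricAlgebra ℂ V →ₗ[ℂ] TensorAlgebra ℂ V,
    ∀ l : List (Fin n), τ (SymmetricAlgebra.algHom ℂ V
        (NormalOrdering.word (fun i => TensorAlgebra.ι ℂ (b i)) l))
      = NormalOrdering.word (fun i => TensorAlgebra.ι ℂ (b i)) (l.insertionSort (· ≤ ·)) := by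
  refine ⟨((MvPolynomial.basisMonomials (Fin n) ℂ).constr ℂ fun m =>
    NormalOrdering.word (fun i => TensorAlgebra.ι ℂ (b i))
      ((Finsupp.toMultiset m).toList.insertionSort (· ≤ ·))) ∘ₗ
      (SymmetricAlgebra.equivMvPolynomial b).toLinearMap, fun l => ?_⟩
  have h : SymmetricAlgebra.equivMvPolynomial b (SymmetricAlgebra.algHom ℂ V
        (NormalOrdering.word (fun i => TensorAlgebra.ι ℂ (b i)) l))
      = MvPolynomial.basisMonomials (Fin n) ℂ (Multiset.toFinsupp (l : Multiset (Fin n))) := by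
    rw [MvPolynomial.coe_basisMonomials]
    induction l with
    | nil => simp
    | cons i l ih =>
      have hi : SymmetricAlgebra.equivMvPolynomial b (SymmetricAlgebra.algHom ℂ V
          (TensorAlgebra.ι ℂ (b i))) = MvPolynomial.X i :=
        SymmetricAlgebra.equivMvPolynomial_ι_apply b i
      rw [NormalOrdering.word_cons, map_mul, map_mul, ih, hi, MvPolynomial.X,
        MvPolynomial.monomial_mul, one_mul, ← Multiset.cons_coe, ← Multiset.singleton_add, map_add,
        Multiset.toFinsupp_singleton]
  rw [LinearMap.comp_apply, AlgEquiv.toLinearMap_apply, h, Module.Basis.constr_basis]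
  refine congrArg _ (NormalOrdering.insertionSort_eq_of_perm ?_)
  rw [Multiset.toFinsupp_toMultiset, ← Multiset.coe_eq_coe, Multiset.coe_toList]

/-- The sorted form of a tensor depends only on its image in S(V), so for such `x` it is zero and
only the defect remains. -/
theorem tensorHom_eq_X_smul {x : TensorAlgebra ℂ V} (hx : SymmetricAlgebra.algHom ℂ V x = 0) :
    tensorHom α a x = (Polynomial.X : ℂ[X]) • tensorDefect b α a x := by
  obtain ⟨τ, hτ⟩ := exists_sortedSection b
  have key : ∀ x, (Polynomial.X : ℂ[X]) • tensorDefect b α a x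
      = tensorHom α a x - tensorHom α a (τ (SymmetricAlgebra.algHom ℂ V x)) := by
    intro x
    induction x using b.tensorAlgebra.induction_linear with
    | h0 => simp
    | hadd x y hx hy => simp only [map_add, smul_add, hx, hy]; abel
    | hsmul c x hx => simp only [map_smul, smul_comm _ c, hx, smul_sub]
    | hb l =>
      have hl := basis_tensorAlgebra_apply b l.toList
      rw [FreeMonoid.ofList_toList] at hl
      rw [hl, hτ, X_smul_tensorDefect_word]
  rw [key, hx, map_zero, map_zero, sub_zero]

theorem pbwHecke_surjective [FiniteDimensional ℂ V] (σ : GradedSection V) :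
    Function.Surjective (pbwHecke α a σ) := by
  let b := Module.finBasis ℂ V
  let R : Submodule ℂ[X] (HeckeAlgebra α a) := LinearMap.range (pbwHecke α a σ)
  have hR : ∀ n, ∀ z ∈ degreeLT α a n, z ∈ R := by
    intro n
    induction n with
    | zero =>
      intro z hz
      have : z = 0 := by simpa [degreeLT] using hz
      exact this ▸ Submodule.zero_mem _
    | succ n ih =>
      intro z hz
      induction hz using Submodule.span_induction with
      | zero => exact Submodule.zero_mem _
      | add y z _ _ hy hz => exact Submodule.add_mem _ hy hz
      | smul c z _ hz =>
        rw [← algebraMap_smul ℂ[X] c z]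
        exact Submodule.smul_mem _ _ hz
      | mem z hz =>
        obtain ⟨m, hm, x, hx, g, rfl⟩ := hz
        let s := SymmetricAlgebra.algHom ℂ V x
        have hy : SymmetricAlgebra.algHom ℂ V (x - σ.toLin s) = 0 := by
          rw [map_sub, σ.section_apply, sub_self]
        -- Gradedness of `σ` keeps the correction in degree `m`, so that its defect falls under the
        -- induction hypothesis.
        have hy' : x - σ.toLin s ∈ tensorDegree V m := Submodule.sub_mem _ hx (σ.graded m x hx)
        have h1 : tensorHom α a (σ.toLin s) * bar α a g ∈ R := by
          refine ⟨1 ⊗ₜ Finsupp.single g s, ?_⟩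
          rw [pbwHecke_tmul, pbwLift_single, one_smul, crossedHom_of]
        have h2 : tensorHom α a (x - σ.toLin s) * bar α a g ∈ R := by
          rw [tensorHom_eq_X_smul b hy, smul_mul_assoc]
          exact Submodule.smul_mem _ _ (ih _ (degreeLT_mono (Nat.le_of_lt_succ hm)
            (mul_bar_mem_degreeLT g (tensorDefect_mem_degreeLT b hy'))))
        have := Submodule.add_mem _ h1 h2
        rwa [← add_mul, ← map_add, add_sub_cancel] at this
  have hcross : ∀ x : TensorCrossed α, crossedHom α a x ∈ R := by
    intro x
    induction x using CrossedProduct.induction with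
    | h0 => rw [map_zero]; exact Submodule.zero_mem _
    | hadd x y hx hy => rw [map_add]; exact Submodule.add_mem _ hx hy
    | hof g x =>
      rw [crossedHom_of]
      induction x using b.tensorAlgebra.induction_linear with
      | h0 => rw [map_zero, zero_mul]; exact Submodule.zero_mem _
      | hadd x y hx hy => rw [map_add, add_mul]; exact Submodule.add_mem _ hx hy
      | hsmul c x hx =>
        rw [map_smul, smul_mul_assoc, ← algebraMap_smul ℂ[X] c]
        exact Submodule.smul_mem _ _ hx
      | hb l =>
        have hl := basis_tensorAlgebra_apply b l.toList
        rw [FreeMonoid.ofList_toList] at hl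
        rw [hl]
        exact hR _ _ (tensorHom_mul_bar_mem_degreeLT (Nat.lt_succ_self _)
          (word_mem_tensorDegree b _) g)
  intro z
  obtain ⟨u, rfl⟩ := RingQuot.mkAlgHom_surjective ℂ[X] (Rel α a) z
  change heckeMk α a u ∈ R
  induction u using TensorProduct.induction_on with
  | zero => rw [map_zero]; exact Submodule.zero_mem _
  | add u v hu hv => rw [map_add]; exact Submodule.add_mem _ hu hv
  | tmul p x => rw [mkAlgHom_tmul]; exact Submodule.smul_mem _ _ (hcross x)

theorem IsAdmissible.isTwistedGradedHecke [FiniteDimensional ℂ V] (h : IsAdmissible α a) :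
    IsTwistedGradedHecke α a :=
  ⟨h.skew, fun σ => by
    rw [coe_pbwMap]
    exact ⟨pbwHecke_injective h σ, pbwHecke_surjective σ⟩⟩

end Surjective

end TwistedHecke

/-- A functional `f` extends to an algebra map S(W) → K[X] with v ↦ f(v) X, and functionals separate
vectors. -/
theorem SymmetricAlgebra.ι_injective_of_field (K W : Type*) [Field K] [AddCommGroup W] [Module K W] :
    Function.Injective (SymmetricAlgebra.ι K W) := by
  rw [injective_iff_map_eq_zero]
  intro v hv
  rw [← Module.forall_dual_apply_eq_zero_iff K]
  intro f
  have h := congrArg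
    (SymmetricAlgebra.lift (LinearMap.toSpanSingleton K K[X] Polynomial.X ∘ₗ f)) hv
  rw [SymmetricAlgebra.lift_ι_apply, map_zero, LinearMap.comp_apply,
    LinearMap.toSpanSingleton_apply] at h
  simpa using h

namespace TwistedHecke

open CrossedProduct

variable {V : Type*} [AddCommGroup V] [Module ℂ V]
  {G : Subgroup (LinearMap.GeneralLinearGroup ℂ V)}

/-! ### Necessity of the conditions -/

section Necessary

theorem GradedSection.toLin_one (σ : GradedSection V) : σ.toLin 1 = 1 := by
  have h := σ.graded 0 1 (by rw [pow_zero]; exact Submodule.one_le.1 le_rfl)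
  rw [pow_zero, Submodule.mem_one, map_one] at h
  obtain ⟨c, hc⟩ := h
  have h1 := σ.section_apply 1
  rw [← hc, AlgHom.commutes, SymmetricAlgebra.algebraMap_eq_one_iff] at h1
  rw [← hc, h1, map_one]

theorem GradedSection.toLin_ι (σ : GradedSection V) (v : V) :
    σ.toLin (SymmetricAlgebra.ι ℂ V v) = TensorAlgebra.ι ℂ v := by
  have h := σ.graded 1 (TensorAlgebra.ι ℂ v) (by rw [pow_one]; exact LinearMap.mem_range_self _ v)
  rw [pow_one] at h
  obtain ⟨w, hw⟩ := h
  change _ = σ.toLin (SymmetricAlgebra.ι ℂ V v) at hw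
  have h1 := σ.section_apply (SymmetricAlgebra.ι ℂ V v)
  rw [← hw] at h1
  rw [← hw, SymmetricAlgebra.ι_injective_of_field ℂ V h1]

variable [Finite G] {α : NormalizedTwoCocycle G} {a : G → V →ₗ[ℂ] V →ₗ[ℂ] ℂ}

/-- Injectivity of the PBW map, tested on elements homogeneous of degree one in t. -/
theorem eq_zero_of_X_smul_sum_eq_zero [Fintype G] {σ : GradedSection V}
    (hσ : Function.Injective (pbwHecke α a σ)) {c : G → SymmetricAlgebra ℂ V}
    (hc : (Polynomial.X : ℂ[X]) • ∑ k : G, tensorHom α a (σ.toLin (c k)) * bar α a k = 0)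
    (k : G) : c k = 0 := by
  classical
  have h : pbwHecke α a σ ((Polynomial.X : ℂ[X]) ⊗ₜ[ℂ] ∑ k : G, Finsupp.single k (c k)) = 0 := by
    rw [← hc, pbwHecke_tmul, map_sum, map_sum]
    congr 1
    exact Finset.sum_congr rfl fun k _ => by rw [pbwLift_single, crossedHom_of]
  rw [← map_zero (pbwHecke α a σ)] at h
  have h' := congrArg (tensorCoeff _ 1) (hσ h)
  rw [tensorCoeff_tmul, Polynomial.coeff_X_one, one_smul, map_zero] at h'
  have := DFunLike.congr_fun h' k
  simpa [Finsupp.finsetSum_apply, Finsupp.single_apply] using this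

theorem IsTwistedGradedHecke.isAdmissible [FiniteDimensional ℂ V]
    (h : IsTwistedGradedHecke α a) : IsAdmissible α a := by
  cases nonempty_fintype G
  obtain ⟨σ⟩ := nonempty_gradedSection (V := V)
  have hσ : Function.Injective (pbwHecke α a σ) := (h.2 σ).1
  refine ⟨h.1, fun g k v w => ?_, fun k u v w => ?_⟩
  · have h1 := congrArg (crossedHom α a) (of_one_mul_inclusion (tensorAction G) α g
      (TensorAlgebra.ι ℂ v * TensorAlgebra.ι ℂ w - TensorAlgebra.ι ℂ w * TensorAlgebra.ι ℂ v))
    have h2 : ∀ v w : V, crossedHom α a (inclusion _ α (TensorAlgebra.ι ℂ v * TensorAlgebra.ι ℂ w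
        - TensorAlgebra.ι ℂ w * TensorAlgebra.ι ℂ v))
        = (Polynomial.X : ℂ[X]) • bracketForm α a v w := fun v w => by
      rw [← tensorHom_bracket, ← map_mul (tensorHom α a), ← map_mul (tensorHom α a), ← map_sub]
      rfl
    rw [map_mul, map_mul, tensorAction_bracket, h2, h2] at h1
    change bar α a g * _ = _ * bar α a g at h1
    rw [mul_smul_comm, smul_mul_assoc, ← sub_eq_zero, ← smul_sub] at h1
    -- Both sides are re-expanded in the elements k̄; the coefficients are compared at the group
    -- element `g * k`.
    have h3 : bar α a g * bracketForm α a v w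
        = ∑ k : G, (a (g⁻¹ * k) v w * (α g (g⁻¹ * k) : ℂ)) • bar α a k := by
      simp only [bracketForm_apply, Finset.mul_sum, mul_smul_comm, bar_mul_bar, smul_smul]
      refine Fintype.sum_equiv (Equiv.mulLeft g) _ _ fun k => ?_
      simp
    have h4 : bracketForm α a (g • v) (g • w) * bar α a g
        = ∑ k : G, (a (k * g⁻¹) (g • v) (g • w) * (α (k * g⁻¹) g : ℂ)) • bar α a k := by
      simp only [bracketForm_apply, Finset.sum_mul, smul_mul_assoc, bar_mul_bar, smul_smul]
      refine Fintype.sum_equiv (Equiv.mulRight g) _ _ fun k => ?_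
      simp
    rw [h3, h4, ← Finset.sum_sub_distrib] at h1
    have h5 := eq_zero_of_X_smul_sum_eq_zero hσ (c := fun k => algebraMap ℂ _
      (a (g⁻¹ * k) v w * (α g (g⁻¹ * k) : ℂ)
        - a (k * g⁻¹) (g • v) (g • w) * (α (k * g⁻¹) g : ℂ))) (by
      rw [← h1]
      congr 1
      refine Finset.sum_congr rfl fun k _ => ?_
      rw [Algebra.algebraMap_eq_smul_one, map_smul, σ.toLin_one, map_smul, map_one, smul_one_mul,
        sub_smul]) (g * k)
    rw [SymmetricAlgebra.algebraMap_eq_zero_iff, inv_mul_cancel_left, sub_eq_zero] at h5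
    exact h5
  · have h1 : (Polynomial.X : ℂ[X]) • ((bracketForm α a u v * tensorHom α a (TensorAlgebra.ι ℂ w)
          - tensorHom α a (TensorAlgebra.ι ℂ w) * bracketForm α a u v)
        + (bracketForm α a v w * tensorHom α a (TensorAlgebra.ι ℂ u)
          - tensorHom α a (TensorAlgebra.ι ℂ u) * bracketForm α a v w)
        + (bracketForm α a w u * tensorHom α a (TensorAlgebra.ι ℂ v)
          - tensorHom α a (TensorAlgebra.ι ℂ v) * bracketForm α a w u)) = 0 := by
      have hX : ∀ (u v : V) (z : HeckeAlgebra α a), (Polynomial.X : ℂ[X]) •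
          (bracketForm α a u v * z - z * bracketForm α a u v)
          = ((Polynomial.X : ℂ[X]) • bracketForm α a u v) * z
            - z * ((Polynomial.X : ℂ[X]) • bracketForm α a u v) := fun u v z => by
        rw [smul_sub, smul_mul_assoc, mul_smul_comm]
      simp only [smul_add, hX, ← tensorHom_bracket]
      -- After replacing t κ by commutators, this is the Jacobi identity of an associative ring.
      noncomm_ring
    rw [bracketForm_commutator, bracketForm_commutator, bracketForm_commutator,
      ← Finset.sum_add_distrib, ← Finset.sum_add_distrib] at h1
    have h2 := eq_zero_of_X_smul_sum_eq_zero hσ (c := fun k => SymmetricAlgebra.ι ℂ V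
      (a k u v • (k • w - w) + a k v w • (k • u - u) + a k w u • (k • v - v))) (by
      rw [← h1]
      congr 1
      refine Finset.sum_congr rfl fun k _ => ?_
      rw [σ.toLin_ι, map_add, map_add, map_add, map_add, add_mul, add_mul]) k
    exact (map_eq_zero_iff _ (SymmetricAlgebra.ι_injective_of_field ℂ V)).1 h2

end Necessary

end TwistedHecke

/-! ### Alternating forms in codimension two -/

/-- An alternating form on a plane is multiplied by the determinant under an endomorphism. -/
theorem LinearMap.map_map_eq_det_mul_of_finrank_eq_two {K W : Type*} [Field K] [AddCommGroup W]
    [Module K W] (hW : Module.finrank K W = 2) (c : W →ₗ[K] W →ₗ[K] K)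
    (halt : ∀ x, c x x = 0) (hskew : ∀ x y, c x y = - c y x) (P : W →ₗ[K] W) (x y : W) :
    c (P x) (P y) = LinearMap.det P * c x y := by
  have : FiniteDimensional K W := Module.finite_of_finrank_eq_succ hW
  let e := Module.finBasisOfFinrankEq K W hW
  have hP : ∀ j, P (e j) = LinearMap.toMatrix e e P 0 j • e 0
      + LinearMap.toMatrix e e P 1 j • e 1 := by
    intro j
    rw [← Fin.sum_univ_two (fun i => LinearMap.toMatrix e e P i j • e i)]
    simp only [LinearMap.toMatrix_apply]
    exact (e.sum_repr _).symm
  have h10 := hskew (e 1) (e 0)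
  have key : c.compl₁₂ P P = LinearMap.det P • c := by
    refine e.ext fun i => e.ext fun j => ?_
    rw [LinearMap.compl₁₂_apply, LinearMap.smul_apply, LinearMap.smul_apply,
      ← LinearMap.det_toMatrix e, Matrix.det_fin_two, hP i, hP j]
    simp only [map_add, map_smul, LinearMap.add_apply, LinearMap.smul_apply, smul_eq_mul, halt]
    fin_cases i <;> fin_cases j <;> simp [halt, h10] <;> ring
  exact LinearMap.congr_fun (LinearMap.congr_fun key x) y

/-- Coordinates transverse to a subspace of codimension two. -/
theorem Submodule.exists_coordinates_of_finrank_quotient_eq_two {K W : Type*} [Field K]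
    [AddCommGroup W] [Module K W] (F : Submodule K W) (hF : Module.finrank K (W ⧸ F) = 2) :
    ∃ (c₀ c₁ : W →ₗ[K] K) (e₀ e₁ : W), (∀ v, v ∈ F ↔ c₀ v = 0 ∧ c₁ v = 0) ∧
      c₀ e₀ = 1 ∧ c₀ e₁ = 0 ∧ c₁ e₀ = 0 ∧ c₁ e₁ = 1 := by
  have : FiniteDimensional K (W ⧸ F) := Module.finite_of_finrank_eq_succ hF
  let e := Module.finBasisOfFinrankEq K (W ⧸ F) hF
  obtain ⟨e₀, h₀⟩ := F.mkQ_surjective (e 0)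
  obtain ⟨e₁, h₁⟩ := F.mkQ_surjective (e 1)
  refine ⟨e.coord 0 ∘ₗ F.mkQ, e.coord 1 ∘ₗ F.mkQ, e₀, e₁, fun v => ?_, ?_, ?_, ?_, ?_⟩
  · rw [← Submodule.Quotient.mk_eq_zero, ← e.forall_coord_eq_zero_iff, Fin.forall_fin_two]
    rfl
  all_goals simp [LinearMap.comp_apply, h₀, h₁, -Submodule.mkQ_apply]

namespace TwistedHecke

variable {V : Type*} [AddCommGroup V] [Module ℂ V]
  {G : Subgroup (LinearMap.GeneralLinearGroup ℂ V)}

theorem IsSkew.apply_self {b : V →ₗ[ℂ] V →ₗ[ℂ] ℂ} (hb : IsSkew b) (v : V) : b v v = 0 :=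
  self_eq_neg.1 (hb v v)

theorem mem_fixedSpace (g : G) (v : V) :
    v ∈ fixedSpace (g : LinearMap.GeneralLinearGroup ℂ V) ↔ g • v = v := Iff.rfl

theorem smul_mem_fixedSpace {g h : G} (hgh : h * g = g * h) {v : V}
    (hv : v ∈ fixedSpace (g : LinearMap.GeneralLinearGroup ℂ V)) :
    h • v ∈ fixedSpace (g : LinearMap.GeneralLinearGroup ℂ V) := by
  rw [mem_fixedSpace] at hv ⊢
  rw [smul_smul, ← hgh, mul_smul, hv]

theorem IsSkew.eq_det_mul {b : V →ₗ[ℂ] V →ₗ[ℂ] ℂ} (hb : IsSkew b) {F : Submodule ℂ V}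
    (hF : F ≤ LinearMap.ker b) {c₀ c₁ : V →ₗ[ℂ] ℂ} {e₀ e₁ : V}
    (hc : ∀ v, v ∈ F ↔ c₀ v = 0 ∧ c₁ v = 0)
    (h00 : c₀ e₀ = 1) (h01 : c₀ e₁ = 0) (h10 : c₁ e₀ = 0) (h11 : c₁ e₁ = 1) (v w : V) :
    b v w = (c₀ v * c₁ w - c₁ v * c₀ w) * b e₀ e₁ := by
  have hd : ∀ v, ∃ f ∈ F, v = f + c₀ v • e₀ + c₁ v • e₁ := fun v =>
    ⟨v - c₀ v • e₀ - c₁ v • e₁, (hc _).2 (by simp [h00, h01, h10, h11]), by abel⟩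
  have hl : ∀ f ∈ F, ∀ x, b f x = 0 := fun f hf x => by
    rw [LinearMap.mem_ker.1 (hF hf), LinearMap.zero_apply]
  have hr : ∀ f ∈ F, ∀ x, b x f = 0 := fun f hf x => by rw [hb, hl f hf, neg_zero]
  obtain ⟨f, hf, hv⟩ := hd v
  obtain ⟨f', hf', hw⟩ := hd w
  conv_lhs => rw [hv, hw]
  simp only [map_add, map_smul, LinearMap.add_apply, LinearMap.smul_apply, smul_eq_mul,
    hl f hf, hr f' hf', hb.apply_self]
  rw [hb e₁ e₀]
  ring

variable [Finite G]

/-! ### The determinant of `hPerp` as a scaling factor -/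

section Determinant

theorem smul_sub_hPerp_mem (B : InvariantHermitianForm G) (g h : G) (p : perpSpace B g) :
    h • (p : V) - (hPerp B g h p : V) ∈ fixedSpace (g : LinearMap.GeneralLinearGroup ℂ V) := by
  have hq := (Submodule.quotientEquivOfIsCompl _ _ (isCompl_fixedSpace_perpSpace B g)).symm_apply_apply
    (Submodule.Quotient.mk (h • (p : V)))
  rw [Submodule.quotientEquivOfIsCompl_symm_apply, eq_comm, Submodule.Quotient.eq] at hq
  exact hq

theorem finrank_perpSpace (B : InvariantHermitianForm G) (g : G) :
    Module.finrank ℂ (perpSpace B g)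
      = Module.finrank ℂ (V ⧸ fixedSpace (g : LinearMap.GeneralLinearGroup ℂ V)) :=
  (Submodule.quotientEquivOfIsCompl _ _ (isCompl_fixedSpace_perpSpace B g)).finrank_eq.symm

/-- Since `h` commutes with `g`, it preserves V^g, on which `b` vanishes; modulo V^g it acts on the
plane (V^g)^⊥ as `hPerp`. -/
theorem IsSkew.smul_smul_eq_det_hPerp (B : InvariantHermitianForm G) {g h : G}
    (hgh : h * g = g * h) {b : V →ₗ[ℂ] V →ₗ[ℂ] ℂ} (hb : IsSkew b)
    (hker : fixedSpace (g : LinearMap.GeneralLinearGroup ℂ V) ≤ LinearMap.ker b)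
    (hcodim : Module.finrank ℂ (V ⧸ fixedSpace (g : LinearMap.GeneralLinearGroup ℂ V)) = 2)
    (v w : V) : b (h • v) (h • w) = LinearMap.det (hPerp B g h) * b v w := by
  have hl : ∀ f ∈ fixedSpace (g : LinearMap.GeneralLinearGroup ℂ V), ∀ x, b f x = 0 :=
    fun f hf x => by rw [LinearMap.mem_ker.1 (hker hf), LinearMap.zero_apply]
  have hr : ∀ f ∈ fixedSpace (g : LinearMap.GeneralLinearGroup ℂ V), ∀ x, b x f = 0 :=
    fun f hf x => by rw [hb, hl f hf, neg_zero]
  have hd : ∀ v : V, ∃ f ∈ fixedSpace (g : LinearMap.GeneralLinearGroup ℂ V),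
      ∃ p : perpSpace B g, v = f + p := fun v => by
    have hv : v ∈ fixedSpace (g : LinearMap.GeneralLinearGroup ℂ V) ⊔ perpSpace B g := by
      rw [(isCompl_fixedSpace_perpSpace B g).sup_eq_top]
      trivial
    obtain ⟨f, hf, p, hp, h⟩ := Submodule.mem_sup.1 hv
    exact ⟨f, hf, ⟨p, hp⟩, h.symm⟩
  have hp : ∀ p : perpSpace B g, ∃ f ∈ fixedSpace (g : LinearMap.GeneralLinearGroup ℂ V),
      h • (p : V) = f + (hPerp B g h p : V) := fun p =>
    ⟨_, smul_sub_hPerp_mem B g h p, by abel⟩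
  obtain ⟨f, hf, p, rfl⟩ := hd v
  obtain ⟨f', hf', p', rfl⟩ := hd w
  obtain ⟨k, hk, hkp⟩ := hp p
  obtain ⟨k', hk', hkp'⟩ := hp p'
  have hhf := smul_mem_fixedSpace hgh hf
  have hhf' := smul_mem_fixedSpace hgh hf'
  have key := LinearMap.map_map_eq_det_mul_of_finrank_eq_two
    ((finrank_perpSpace B g).trans hcodim)
    (b.compl₁₂ (perpSpace B g).subtype (perpSpace B g).subtype)
    (fun x => hb.apply_self _) (fun x y => hb _ _) (hPerp B g h) p p'
  simp only [LinearMap.compl₁₂_apply, Submodule.subtype_apply] at key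
  simp only [smul_add, hkp, hkp', map_add, LinearMap.add_apply, hl f hf, hr f' hf', hl k hk,
    hr k' hk', hl _ hhf, hr _ hhf', zero_add, key]

end Determinant

/-! ### The form attached to a nontrivial group element -/

section Kernel

variable {α : NormalizedTwoCocycle G} {a : G → V →ₗ[ℂ] V →ₗ[ℂ] ℂ}

theorem IsAdmissible.apply_smul_smul (h : IsAdmissible α a) (g : G) (v w : V) :
    a g (g • v) (g • w) = a g v w := by
  have := h.conj g g v w
  rw [mul_inv_cancel_right] at this
  exact (mul_right_cancel₀ (Units.ne_zero _) this).symm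

theorem exists_smul_ne {g : G} (hg : g ≠ 1) : ∃ w : V, g • w ≠ w := by
  by_contra! hc
  refine hg (Subtype.ext (Units.ext (LinearMap.ext fun v => ?_)))
  exact hc v

/-- For two fixed vectors and a moved one, the Jacobi identity has a single term, so a_g vanishes on
V^g × V^g. As a_g is g-invariant, a_g(u, ·) with `u` fixed takes the same value on all g^k w, and
summing over k replaces `w` by a fixed vector. -/
theorem IsAdmissible.fixedSpace_le_ker (h : IsAdmissible α a) {g : G} (hg : g ≠ 1) :
    fixedSpace (g : LinearMap.GeneralLinearGroup ℂ V) ≤ LinearMap.ker (a g) := by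
  obtain ⟨w₀, hw₀⟩ := exists_smul_ne hg
  have hfix : ∀ u v : V, g • u = u → g • v = v → a g u v = 0 := by
    intro u v hu hv
    have := h.jacobi g u v w₀
    rw [hu, hv, sub_self, sub_self, smul_zero, smul_zero, add_zero, add_zero] at this
    exact (smul_eq_zero.1 this).resolve_right (sub_ne_zero.2 hw₀)
  intro u hu
  rw [mem_fixedSpace] at hu
  rw [LinearMap.mem_ker]
  ext w
  have hpow : ∀ k : ℕ, a g u ((g ^ k) • w) = a g u w := by
    intro k
    induction k with
    | zero => simp
    | succ k ih =>
      rw [← ih, pow_succ', mul_smul]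
      conv_lhs => rw [← hu]
      exact h.apply_smul_smul g _ _
  have havg : g • ∑ k ∈ Finset.range (orderOf g), (g ^ k) • w
      = ∑ k ∈ Finset.range (orderOf g), (g ^ k) • w := by
    simp only [Finset.smul_sum, smul_smul, ← pow_succ']
    have h1 := Finset.sum_range_succ (fun k => (g ^ k) • w) (orderOf g)
    rw [Finset.sum_range_succ', pow_orderOf_eq_one, pow_zero] at h1
    exact add_right_cancel h1
  have h0 := hfix u _ hu havg
  simp only [map_sum, hpow, Finset.sum_const, Finset.card_range, nsmul_eq_mul] at h0
  exact (mul_eq_zero.1 h0).resolve_left (by exact_mod_cast (orderOf_pos g).ne')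

/-- If a_g(u, v) ≠ 0, the Jacobi identity can be solved for gw - w, so gu - u and gv - v span the
image of g - 1. -/
theorem IsAdmissible.finrank_quotient_fixedSpace_le [FiniteDimensional ℂ V]
    (h : IsAdmissible α a) {g : G} (ha : a g ≠ 0) :
    Module.finrank ℂ (V ⧸ fixedSpace (g : LinearMap.GeneralLinearGroup ℂ V)) ≤ 2 := by
  classical
  obtain ⟨u, v, huv⟩ : ∃ u v, a g u v ≠ 0 := by
    by_contra! hc
    exact ha (LinearMap.ext fun u => LinearMap.ext fun v => hc u v)
  let f : V →ₗ[ℂ] V := ((g : LinearMap.GeneralLinearGroup ℂ V) : V →ₗ[ℂ] V) - LinearMap.id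
  have hf : ∀ x, f x = g • x - x := fun _ => rfl
  have hker : LinearMap.ker f = fixedSpace (g : LinearMap.GeneralLinearGroup ℂ V) := by
    ext x
    rw [LinearMap.mem_ker, hf, sub_eq_zero]
    rfl
  rw [← hker, f.quotKerEquivRange.finrank_eq]
  have hrange : LinearMap.range f ≤ Submodule.span ℂ (({f u, f v} : Finset V) : Set V) := by
    rintro _ ⟨w, rfl⟩
    have hj := h.jacobi g u v w
    rw [← hf, ← hf, ← hf] at hj
    have hw : f w = (-(a g u v)⁻¹ * a g v w) • f u + (-(a g u v)⁻¹ * a g w u) • f v := by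
      have h1 : a g u v • f w = -(a g v w • f u + a g w u • f v) := by
        rw [eq_neg_iff_add_eq_zero, ← add_assoc]
        exact hj
      rw [mul_smul, mul_smul, ← smul_add, neg_smul, ← smul_neg, ← h1, inv_smul_smul₀ huv]
    rw [hw]
    exact Submodule.add_mem _ (Submodule.smul_mem _ _ (Submodule.subset_span (by simp)))
      (Submodule.smul_mem _ _ (Submodule.subset_span (by simp)))
  exact (Submodule.finrank_mono hrange).trans ((finrank_span_finset_le_card _).trans
    Finset.card_le_two)

theorem IsSkew.two_le_finrank_quotient_ker [FiniteDimensional ℂ V] {b : V →ₗ[ℂ] V →ₗ[ℂ] ℂ}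
    (hb : IsSkew b) (h0 : b ≠ 0) : 2 ≤ Module.finrank ℂ (V ⧸ LinearMap.ker b) := by
  obtain ⟨u, v, huv⟩ : ∃ u v, b u v ≠ 0 := by
    by_contra! hc
    exact h0 (LinearMap.ext fun u => LinearMap.ext fun v => hc u v)
  rw [b.quotKerEquivRange.finrank_eq]
  have hli : LinearIndependent ℂ ![(⟨b u, u, rfl⟩ : LinearMap.range b), ⟨b v, v, rfl⟩] := by
    rw [LinearIndependent.pair_iff]
    intro s t hst
    have hst' : s • b u + t • b v = 0 := congrArg Subtype.val hst
    have h1 := LinearMap.congr_fun hst' u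
    have h2 := LinearMap.congr_fun hst' v
    simp only [LinearMap.add_apply, LinearMap.smul_apply, smul_eq_mul, hb.apply_self, mul_zero,
      zero_add, add_zero, LinearMap.zero_apply, mul_eq_zero] at h1 h2
    rw [hb v u, neg_eq_zero] at h1
    exact ⟨h2.resolve_right huv, h1.resolve_right huv⟩
  simpa using hli.fintype_card_le_finrank

theorem IsAdmissible.ker_eq_and_finrank_eq [FiniteDimensional ℂ V] (h : IsAdmissible α a)
    {g : G} (hg : g ≠ 1) (ha : a g ≠ 0) :
    LinearMap.ker (a g) = fixedSpace (g : LinearMap.GeneralLinearGroup ℂ V) ∧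
      Module.finrank ℂ (V ⧸ fixedSpace (g : LinearMap.GeneralLinearGroup ℂ V)) = 2 := by
  have h1 := h.finrank_quotient_fixedSpace_le ha
  have h2 := (h.skew g).two_le_finrank_quotient_ker ha
  have h3 := h.fixedSpace_le_ker hg
  have h4 := Submodule.finrank_quotient_add_finrank (LinearMap.ker (a g))
  have h5 := Submodule.finrank_quotient_add_finrank
    (fixedSpace (g : LinearMap.GeneralLinearGroup ℂ V))
  have h6 := Submodule.finrank_mono h3
  exact ⟨(Submodule.eq_of_le_of_finrank_le h3 (by omega)).symm, by omega⟩

theorem IsAdmissible.det_hPerp [FiniteDimensional ℂ V] (h : IsAdmissible α a)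
    (B : InvariantHermitianForm G) {g : G} (hg : g ≠ 1) (ha : a g ≠ 0) {k : G}
    (hk : k * g = g * k) :
    LinearMap.det (hPerp B g k) = ((α k g * (α g k)⁻¹ : ℂˣ) : ℂ) := by
  obtain ⟨hker, hcodim⟩ := h.ker_eq_and_finrank_eq hg ha
  obtain ⟨u, v, huv⟩ : ∃ u v, a g u v ≠ 0 := by
    by_contra! hc
    exact ha (LinearMap.ext fun u => LinearMap.ext fun v => hc u v)
  have h1 := h.conj k g u v
  rw [hk, mul_inv_cancel_right, (h.skew g).smul_smul_eq_det_hPerp B hk hker.ge hcodim] at h1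
  rw [Units.val_mul, Units.val_inv_eq_inv_val, eq_mul_inv_iff_mul_eq₀ (Units.ne_zero _)]
  refine mul_left_cancel₀ huv ?_
  rw [h1]
  ring

end Kernel

/-! ### Construction of admissible forms -/

section Construction

/-- In a plane, b(u, v) w + b(v, w) u + b(w, u) v = 0 by Cramer's rule. Hence this vector of V lies
in V^g, and g - 1 annihilates it. -/
theorem IsSkew.jacobi_of_ker_eq {g : G} {b : V →ₗ[ℂ] V →ₗ[ℂ] ℂ} (hb : IsSkew b)
    (hker : LinearMap.ker b = fixedSpace (g : LinearMap.GeneralLinearGroup ℂ V))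
    (hcodim : Module.finrank ℂ (V ⧸ fixedSpace (g : LinearMap.GeneralLinearGroup ℂ V)) = 2)
    (u v w : V) :
    b u v • (g • w - w) + b v w • (g • u - u) + b w u • (g • v - v) = 0 := by
  obtain ⟨c₀, c₁, e₀, e₁, hc, h00, h01, h10, h11⟩ :=
    Submodule.exists_coordinates_of_finrank_quotient_eq_two _ hcodim
  have hb' := hb.eq_det_mul hker.ge hc h00 h01 h10 h11
  have hmem : b u v • w + b v w • u + b w u • v
      ∈ fixedSpace (g : LinearMap.GeneralLinearGroup ℂ V) := by
    rw [hc, hb' u v, hb' v w, hb' w u]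
    simp only [map_add, map_smul, smul_eq_mul]
    constructor <;> ring
  rw [mem_fixedSpace] at hmem
  have hs : ∀ (c : ℂ) (x : V), g • c • x = c • g • x := fun c x =>
    map_smul ((g : LinearMap.GeneralLinearGroup ℂ V) : V →ₗ[ℂ] V) c x
  rw [smul_add, smul_add, hs, hs, hs, ← sub_eq_zero] at hmem
  rw [← hmem]
  simp only [smul_sub]
  abel

theorem exists_isSkew_ker_eq {F : Submodule ℂ V} (hF : Module.finrank ℂ (V ⧸ F) = 2) :
    ∃ b : V →ₗ[ℂ] V →ₗ[ℂ] ℂ, IsSkew b ∧ LinearMap.ker b = F ∧ b ≠ 0 := by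
  obtain ⟨c₀, c₁, e₀, e₁, hc, h00, h01, h10, h11⟩ :=
    Submodule.exists_coordinates_of_finrank_quotient_eq_two F hF
  let b := (LinearMap.mul ℂ ℂ).compl₁₂ c₀ c₁ - (LinearMap.mul ℂ ℂ).compl₁₂ c₁ c₀
  have hb : ∀ v w, b v w = c₀ v * c₁ w - c₁ v * c₀ w := fun _ _ => rfl
  refine ⟨b, fun v w => by rw [hb, hb]; ring, ?_, fun h0 => ?_⟩
  · ext v
    rw [LinearMap.mem_ker, hc]
    constructor
    · intro hv
      have h0 := LinearMap.congr_fun hv e₀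
      have h1 := LinearMap.congr_fun hv e₁
      rw [hb, h00, h10] at h0
      rw [hb, h01, h11] at h1
      simp at h0 h1
      exact ⟨h1, h0⟩
    · rintro ⟨h0, h1⟩
      ext w
      rw [hb, h0, h1]
      simp
  · have := LinearMap.congr_fun (LinearMap.congr_fun h0 e₀) e₁
    rw [hb, h00, h11, h01, h10] at this
    simp at this

open Classical in
/-- The sum over the group elements `h` with `h g h⁻¹ = k` of the form `b` transported by
conjugation with `h̄`, normalized by the order of the centralizer of `g`. -/
def conjugateForm (α : NormalizedTwoCocycle G) (g : G) (b : V →ₗ[ℂ] V →ₗ[ℂ] ℂ) (k : G) :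
    V →ₗ[ℂ] V →ₗ[ℂ] ℂ :=
  letI := Fintype.ofFinite G
  (Fintype.card {h : G // h * g * h⁻¹ = g} : ℂ)⁻¹ • ∑ h : G,
    if h * g * h⁻¹ = k then ((α h g : ℂ) * (α k h : ℂ)⁻¹) •
      b.compl₁₂ (((h⁻¹ : G) : LinearMap.GeneralLinearGroup ℂ V) : V →ₗ[ℂ] V)
        (((h⁻¹ : G) : LinearMap.GeneralLinearGroup ℂ V) : V →ₗ[ℂ] V) else 0

variable (α : NormalizedTwoCocycle G) (g : G) (b : V →ₗ[ℂ] V →ₗ[ℂ] ℂ)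

open Classical in
theorem conjugateForm_apply [Fintype G] (k : G) (v w : V) :
    conjugateForm α g b k v w = (Fintype.card {h : G // h * g * h⁻¹ = g} : ℂ)⁻¹ * ∑ h : G,
      if h * g * h⁻¹ = k then (α h g : ℂ) * (α k h : ℂ)⁻¹ * b (h⁻¹ • v) (h⁻¹ • w) else 0 := by
  rw [conjugateForm, LinearMap.smul_apply, LinearMap.smul_apply, smul_eq_mul, LinearMap.sum_apply,
    LinearMap.sum_apply]
  congr 2
  · congr!
  · congr!
  · ext h
    split_ifs <;> rfl

/-- In the twisted group algebra h̄ ḡ h̄⁻¹ = α(h, g) α(k, h)⁻¹ k̄. The identity states that these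
scalars compose when one conjugates by h and then by h', since the basis element of h'h is a scalar
multiple of the product of those of h' and h. -/
theorem cocycle_conj {h h' k k' : G} (hk : h * g = k * h) (hk' : h' * k = k' * h') :
    (α (h' * h) g : ℂ) * (α k' (h' * h) : ℂ)⁻¹ * (α k' h' : ℂ)
      = (α h g : ℂ) * (α k h : ℂ)⁻¹ * (α h' k : ℂ) := by
  have c : ∀ x y z : G, (α x y : ℂ) * (α (x * y) z : ℂ) = (α y z : ℂ) * (α x (y * z) : ℂ) :=
    fun x y z => by exact_mod_cast congrArg Units.val (α.cocycle x y z)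
  have c1 := c h' h g
  have c2 := c k' h' h
  have c3 := c h' k h
  rw [← hk'] at c2
  rw [← hk] at c3
  have n1 := (α k' (h' * h)).ne_zero
  have n2 := (α k h).ne_zero
  have n3 := (α h' h).ne_zero
  have n4 := (α (h' * k) h).ne_zero
  have key : (α (h' * h) g : ℂ) * (α k' h' : ℂ) * (α k h : ℂ)
      = (α h g : ℂ) * (α h' k : ℂ) * (α k' (h' * h) : ℂ) := by
    refine mul_left_cancel₀ (mul_ne_zero n3 n4) ?_
    linear_combination (α k' h' : ℂ) * (α (h' * k) h : ℂ) * (α k h : ℂ) * c1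
      + (α h g : ℂ) * (α h' (h * g) : ℂ) * (α k h : ℂ) * c2
      - (α h g : ℂ) * (α k' (h' * h) : ℂ) * (α h' h : ℂ) * c3
  field_simp
  linear_combination key

variable {α g b}

/-- Conjugation compatibility comes from the substitution h ↦ h'h and `cocycle_conj`; the Jacobi
identity holds summand by summand, transported by `h`. The determinant condition plays no role:
without it the sum is still admissible but may fail to return `b` at `g`. -/
theorem isAdmissible_conjugateForm (hb : IsSkew b)
    (hker : LinearMap.ker b = fixedSpace (g : LinearMap.GeneralLinearGroup ℂ V))
    (hcodim : Module.finrank ℂ (V ⧸ fixedSpace (g : LinearMap.GeneralLinearGroup ℂ V)) = 2) :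
    IsAdmissible α (conjugateForm α g b) := by
  classical
  cases nonempty_fintype G
  refine ⟨fun k v w => ?_, fun h' k v w => ?_, fun k u v w => ?_⟩
  · rw [conjugateForm_apply, conjugateForm_apply, ← mul_neg, ← Finset.sum_neg_distrib]
    congr 1
    refine Finset.sum_congr rfl fun h _ => ?_
    rw [hb (h⁻¹ • v)]
    split_ifs
    · ring
    · simp
  · rw [conjugateForm_apply, conjugateForm_apply, mul_assoc, mul_assoc, Finset.sum_mul,
      Finset.sum_mul]
    congr 1
    refine Fintype.sum_equiv (Equiv.mulLeft h') _ _ fun h => ?_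
    rw [Equiv.coe_mulLeft]
    have hiff : h' * h * g * (h' * h)⁻¹ = h' * k * h'⁻¹ ↔ h * g * h⁻¹ = k := by
      rw [mul_inv_rev, ← mul_assoc, mul_left_inj, mul_assoc h', mul_assoc h', mul_right_inj]
    simp only [hiff]
    split_ifs with hk
    · have := cocycle_conj α g (h := h) (h' := h') (k := k) (k' := h' * k * h'⁻¹)
        (by rw [← hk]; group) (by group)
      rw [mul_right_comm, ← this, mul_right_comm, mul_inv_rev, mul_smul, mul_smul,
        inv_smul_smul, inv_smul_smul]
    · simp
  · simp only [conjugateForm_apply, mul_smul, ← smul_add, Finset.sum_smul,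
      ← Finset.sum_add_distrib]
    rw [Finset.sum_eq_zero, smul_zero]
    intro h _
    split_ifs with hk
    · have hj := congrArg (h • ·) (hb.jacobi_of_ker_eq hker hcodim (h⁻¹ • u) (h⁻¹ • v) (h⁻¹ • w))
      have hs : ∀ (c : ℂ) (x : V), h • c • x = c • h • x := fun c x =>
        map_smul ((h : LinearMap.GeneralLinearGroup ℂ V) : V →ₗ[ℂ] V) c x
      have hx : ∀ x : V, h • (g • h⁻¹ • x - h⁻¹ • x) = k • x - x := fun x => by
        rw [smul_sub, smul_inv_smul, ← hk, mul_smul, mul_smul]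
      simp only [smul_add, hs, hx, smul_zero] at hj
      simp only [mul_smul, ← smul_add, hj, smul_zero]
    · simp

theorem conjugateForm_self (B : InvariantHermitianForm G) (hb : IsSkew b)
    (hker : LinearMap.ker b = fixedSpace (g : LinearMap.GeneralLinearGroup ℂ V))
    (hcodim : Module.finrank ℂ (V ⧸ fixedSpace (g : LinearMap.GeneralLinearGroup ℂ V)) = 2)
    (hdet : ∀ h : G, h * g = g * h →
      LinearMap.det (hPerp B g h) = ((α h g * (α g h)⁻¹ : ℂˣ) : ℂ)) :
    conjugateForm α g b g = b := by
  classical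
  cases nonempty_fintype G
  ext v w
  rw [conjugateForm_apply]
  -- The determinant condition makes every centralizer term equal to `b`, so the normalized sum is
  -- `b`.
  have hterm : ∀ h : G, (if h * g * h⁻¹ = g then
      (α h g : ℂ) * (α g h : ℂ)⁻¹ * b (h⁻¹ • v) (h⁻¹ • w) else 0)
      = if h * g * h⁻¹ = g then b v w else 0 := by
    intro h
    split_ifs with hh
    · have hc : h * g = g * h := mul_inv_eq_iff_eq_mul.1 hh
      have := hb.smul_smul_eq_det_hPerp B hc hker.ge hcodim (h⁻¹ • v) (h⁻¹ • w)
      rw [smul_inv_smul, smul_inv_smul, hdet h hc, Units.val_mul, Units.val_inv_eq_inv_val] at this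
      exact this.symm
    · rfl
  have hpos : (Fintype.card {h : G // h * g * h⁻¹ = g} : ℂ) ≠ 0 := by
    have : Nonempty {h : G // h * g * h⁻¹ = g} := ⟨⟨1, by simp⟩⟩
    exact_mod_cast Fintype.card_ne_zero
  rw [Finset.sum_congr rfl fun h _ => hterm h, ← Finset.sum_filter, Finset.sum_const,
    ← Fintype.card_subtype, nsmul_eq_mul, inv_mul_cancel_left₀ hpos]

end Construction

end TwistedHecke

end

theorem theorem2p2 {V : Type*} [AddCommGroup V] [Module ℂ V] [FiniteDimensional ℂ V]
    (G : Subgroup (LinearMap.GeneralLinearGroup ℂ V)) [Finite G]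
    (α : NormalizedTwoCocycle G) (B : TwistedHecke.InvariantHermitianForm G)
    (g : G) (hg : g ≠ 1) :
    ((∃ a : G → V →ₗ[ℂ] V →ₗ[ℂ] ℂ, TwistedHecke.IsTwistedGradedHecke α a ∧ a g ≠ 0) ↔
      (Module.finrank ℂ (V ⧸ TwistedHecke.fixedSpace (g : LinearMap.GeneralLinearGroup ℂ V)) = 2 ∧
        ∀ h : G, h * g = g * h →
          LinearMap.det (TwistedHecke.hPerp B g h) = ((α h g * (α g h)⁻¹ : ℂˣ) : ℂ))) ∧
    (∀ b : V →ₗ[ℂ] V →ₗ[ℂ] ℂ, TwistedHecke.IsSkew b →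
      ((b ≠ 0 ∧ ∃ a : G → V →ₗ[ℂ] V →ₗ[ℂ] ℂ,
          TwistedHecke.IsTwistedGradedHecke α a ∧ a g = b) ↔
        (LinearMap.ker b = TwistedHecke.fixedSpace (g : LinearMap.GeneralLinearGroup ℂ V) ∧
          Module.finrank ℂ
            (V ⧸ TwistedHecke.fixedSpace (g : LinearMap.GeneralLinearGroup ℂ V)) = 2 ∧
          ∀ h : G, h * g = g * h →
            LinearMap.det (TwistedHecke.hPerp B g h) = ((α h g * (α g h)⁻¹ : ℂˣ) : ℂ)))) := by
  refine ⟨⟨?_, ?_⟩, fun b hb => ⟨?_, ?_⟩⟩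
  · rintro ⟨a, ha, hag⟩
    have h := ha.isAdmissible
    exact ⟨(h.ker_eq_and_finrank_eq hg hag).2, fun k hk => h.det_hPerp B hg hag hk⟩
  · rintro ⟨hcodim, hdet⟩
    obtain ⟨b, hb, hker, h0⟩ := TwistedHecke.exists_isSkew_ker_eq hcodim
    refine ⟨TwistedHecke.conjugateForm α g b,
      (TwistedHecke.isAdmissible_conjugateForm hb hker hcodim).isTwistedGradedHecke, ?_⟩
    rwa [TwistedHecke.conjugateForm_self B hb hker hcodim hdet]
  · rintro ⟨h0, a, ha, rfl⟩
    have h := ha.isAdmissible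
    obtain ⟨hker, hcodim⟩ := h.ker_eq_and_finrank_eq hg h0
    exact ⟨hker, hcodim, fun k hk => h.det_hPerp B hg h0 hk⟩
  · rintro ⟨hker, hcodim, hdet⟩
    refine ⟨?_, TwistedHecke.conjugateForm α g b,
      (TwistedHecke.isAdmissible_conjugateForm hb hker hcodim).isTwistedGradedHecke,
      TwistedHecke.conjugateForm_self B hb hker hcodim hdet⟩
    -- The zero form has kernel V, of codimension 0 rather than 2.
    rintro rfl
    rw [LinearMap.ker_zero] at hker
    rw [← hker, Module.finrank_zero_of_subsingleton] at hcodim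
    exact absurd hcodim (by norm_num)
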